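/- A planar orthogonal drawing of a finite simple graph represents the vertices by distinct points of the plane and each edge by a simple curve, joining its two end vertices, that is a chain of horizontal and vertical segments; an edge passes through no vertex other than its two ends, and two edges meet only in common end vertices. A bend is an interior point of an edge where a horizontal and a vertical segment meet. An instance $(G,H,\Gamma_H)$ consists of a finite simple graph $G$, a subgraph $H\subseteq G$, and a planar orthogonal drawing $\Gamma_H$ of $H$, whose vertices and bends have rational coordinates, written in binary. An extension is a planar orthogonal drawing $\Gamma_G$ of $G$ in the plane $\mathbb{R}^2$ whose restriction to $H$ is $\Gamma_H$. Theorem. Let $k\in\{0,1\}$. There is a (deterministic, multi-stack) Turing machine that, given an instance $(G,H,\Gamma_H)$ with $V(G)=V(H)$, decides in time polynomial in the length of its encoding whether $(G,H,\Gamma_H)$ admits an extension with at most $k$ bends per edge. The same holds if the bound of $k$ bends is required only of the edges in $E(G)\setminus E(H)$. -/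

import Mathlib

/-- The geometric data of a drawing in the plane `𝕜 × 𝕜` of a graph with vertices in `V`: the
point of each vertex, and for each edge `uv` the list of its bends in order from `u` to `v`. For a
drawing of a subgraph, the values at other vertices and at other pairs are irrelevant. -/
structure DrawingData (𝕜 V : Type) where
  pos : V → 𝕜 × 𝕜
  bends : V → V → List (𝕜 × 𝕜)

namespace DrawingData

/-- A drawing with rational coordinates, as a drawing in the real plane. -/
noncomputable def toReal {V : Type} (D : DrawingData ℚ V) : DrawingData ℝ V where
  pos v := Prod.map (fun q : ℚ => (q : ℝ)) (fun q : ℚ => (q : ℝ)) (D.pos v)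
  bends u v := (D.bends u v).map (Prod.map (fun q : ℚ => (q : ℝ)) (fun q : ℚ => (q : ℝ)))

/-- The corners of the polygonal curve that represents the edge `uv`, from `u` to `v`. -/
def chain {𝕜 V : Type} (D : DrawingData 𝕜 V) (u v : V) : List (𝕜 × 𝕜) :=
  D.pos u :: (D.bends u v ++ [D.pos v])

end DrawingData

/-- The segments of a polygonal chain, each given by its two ends, in order. -/
def chainSegments {𝕜 : Type} (l : List (𝕜 × 𝕜)) : List ((𝕜 × 𝕜) × (𝕜 × 𝕜)) :=
  l.zip l.tail

/-- The set of points of a polygonal chain. -/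
def chainTrace (l : List (ℝ × ℝ)) : Set (ℝ × ℝ) :=
  {p | ∃ s ∈ chainSegments l, p ∈ segment ℝ s.1 s.2}

/-- The segment is horizontal, and not a single point. -/
def IsHorizontal (s : (ℝ × ℝ) × (ℝ × ℝ)) : Prop :=
  s.1.2 = s.2.2 ∧ s.1.1 ≠ s.2.1

/-- The segment is vertical, and not a single point. -/
def IsVertical (s : (ℝ × ℝ) × (ℝ × ℝ)) : Prop :=
  s.1.1 = s.2.1 ∧ s.1.2 ≠ s.2.2

/-- A chain of horizontal and vertical segments in which a horizontal and a vertical segment meet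
at each inner corner, so that the inner corners are exactly the bends. -/
def IsOrthogonalChain (l : List (ℝ × ℝ)) : Prop :=
  (∀ s ∈ chainSegments l, IsHorizontal s ∨ IsVertical s) ∧
  (∀ (i : ℕ) (s t : (ℝ × ℝ) × (ℝ × ℝ)),
    (chainSegments l)[i]? = some s → (chainSegments l)[i + 1]? = some t →
      (IsHorizontal s ∧ IsVertical t) ∨ (IsVertical s ∧ IsHorizontal t))

/-- No two non-consecutive segments meet. Consecutive segments of an orthogonal chain are
perpendicular and meet in their common corner only, so such a chain is a simple arc. -/
def IsSimpleChain (l : List (ℝ × ℝ)) : Prop :=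
  ∀ (i j : ℕ) (s t : (ℝ × ℝ) × (ℝ × ℝ)), i + 1 < j →
    (chainSegments l)[i]? = some s → (chainSegments l)[j]? = some t →
      Disjoint (segment ℝ s.1 s.2) (segment ℝ t.1 t.2)

/-- `D` is a planar orthogonal drawing of the graph `H`: the vertices are distinct points, each
edge is a simple arc made of horizontal and vertical segments that contains no vertices but its
two ends, and two edges meet in common end vertices only. -/
structure IsPlanarOrthogonalDrawing {V : Type} {G : SimpleGraph V} (H : G.Subgraph)
    (D : DrawingData ℝ V) : Prop where
  bends_symm : ∀ u v, H.Adj u v → D.bends v u = (D.bends u v).reverse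
  pos_injOn : Set.InjOn D.pos H.verts
  orthogonal : ∀ u v, H.Adj u v → IsOrthogonalChain (D.chain u v)
  simple : ∀ u v, H.Adj u v → IsSimpleChain (D.chain u v)
  vertex_on_edge : ∀ u v w, H.Adj u v → w ∈ H.verts →
    D.pos w ∈ chainTrace (D.chain u v) → w = u ∨ w = v
  edge_meet : ∀ u v u' v', H.Adj u v → H.Adj u' v' → s(u, v) ≠ s(u', v') →
    ∀ p, p ∈ chainTrace (D.chain u v) → p ∈ chainTrace (D.chain u' v') →
      ∃ w, w ∈ s(u, v) ∧ w ∈ s(u', v') ∧ p = D.pos w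

/-- An instance of the orthogonal partial representation extension problem: a finite simple graph
`G`, a subgraph `H`, and a planar orthogonal drawing of `H`, with rational coordinates so that the
instance is a finite object. -/
structure RepExtInstance where
  n : ℕ
  G : SimpleGraph (Fin n)
  H : G.Subgraph
  drawing : DrawingData ℚ (Fin n)
  planar : IsPlanarOrthogonalDrawing H drawing.toReal

namespace RepExtInstance

/-- `D` is a planar orthogonal drawing of `G` in the real plane whose restriction to `H` is the
given drawing. -/
structure IsExtension (I : RepExtInstance) (D : DrawingData ℝ (Fin I.n)) : Prop where
  planar : IsPlanarOrthogonalDrawing (⊤ : I.G.Subgraph) D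
  pos_eq : ∀ v ∈ I.H.verts, D.pos v = I.drawing.toReal.pos v
  bends_eq : ∀ u v, I.H.Adj u v → D.bends u v = I.drawing.toReal.bends u v

/-- There is an extension in which each edge of `G` has at most `k` bends. -/
def HasExtension (I : RepExtInstance) (k : ℕ) : Prop :=
  ∃ D : DrawingData ℝ (Fin I.n), I.IsExtension D ∧
    ∀ u v, I.G.Adj u v → (D.bends u v).length ≤ k

/-- There is an extension in which each edge of `G` that is not an edge of `H` has at most `k`
bends. -/
def HasExtensionNewEdges (I : RepExtInstance) (k : ℕ) : Prop :=
  ∃ D : DrawingData ℝ (Fin I.n), I.IsExtension D ∧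
    ∀ u v, I.G.Adj u v → ¬ I.H.Adj u v → (D.bends u v).length ≤ k

end RepExtInstance

/-! ### Encoding of instances as words over a finite alphabet -/

/-- Binary notation of a natural number. -/
def natCode (m : ℕ) : List Computability.Γ' :=
  (Computability.encodeNat m).map Computability.Γ'.bit

/-- Sign bit, numerator and denominator in binary. -/
def ratCode (q : ℚ) : List Computability.Γ' :=
  Computability.Γ'.bit (decide (q < 0)) ::
    (natCode q.num.natAbs ++ [Computability.Γ'.comma] ++ natCode q.den ++ [Computability.Γ'.comma])

/-- The two coordinates between brackets. -/
def pointCode (p : ℚ × ℚ) : List Computability.Γ' :=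
  Computability.Γ'.bra :: (ratCode p.1 ++ ratCode p.2 ++ [Computability.Γ'.ket])

namespace RepExtInstance

open Classical in
/-- The point of a vertex of `H`; a blank for a vertex that is not drawn. -/
noncomputable def vertexCode (I : RepExtInstance) (v : Fin I.n) : List Computability.Γ' :=
  if v ∈ I.H.verts then pointCode (I.drawing.pos v) else [Computability.Γ'.blank]

open Classical in
/-- The two ends of an edge of `G`, one bit that tells whether it is an edge of `H`, and the bends
if it is. -/
noncomputable def edgeCode (I : RepExtInstance) (e : Fin I.n × Fin I.n) : List Computability.Γ' :=
  Computability.Γ'.bra ::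
    (natCode e.1 ++ [Computability.Γ'.comma] ++ natCode e.2 ++ [Computability.Γ'.comma] ++
      (if I.H.Adj e.1 e.2 then
        Computability.Γ'.bit true :: (I.drawing.bends e.1 e.2).flatMap pointCode
      else [Computability.Γ'.bit false]) ++ [Computability.Γ'.ket])

open Classical in
/-- The edges `uv` of `G` with `u < v`, each once, in lexicographic order. -/
noncomputable def edgeList (I : RepExtInstance) : List (Fin I.n × Fin I.n) :=
  (List.finRange I.n ×ˢ List.finRange I.n).filter (fun e => e.1 < e.2 ∧ I.G.Adj e.1 e.2)

/-- The list of the vertices, then the list of the edges of `G`. -/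
noncomputable def encode (I : RepExtInstance) : List Computability.Γ' :=
  (List.finRange I.n).flatMap I.vertexCode ++ [Computability.Γ'.comma] ++
    I.edgeList.flatMap I.edgeCode

end RepExtInstance

/-- A Turing machine decides in time polynomial in the length of the code whether a given object
has the property `P`. -/
def DecidableInPolyTime {α : Type} (code : α → List Computability.Γ') (P : α → Prop) : Prop :=
  ∃ f : α → Bool, (∀ a, f a = true ↔ P a) ∧
    Nonempty (Turing.TM2ComputableInPolyTime code Computability.encodeBool f)

/-!
# Extending orthogonal drawings when all vertices are drawn

Since all vertices have prescribed points, a new edge with at most one bend has very few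
possible shapes. If its ends share a coordinate, it can only be the straight segment between them.
Otherwise it has exactly one bend, which is one of the two corners of the rectangle spanned by the
ends. So each edge `e` has at most two candidate routes, `(e, false)` and `(e, true)`, and for an
edge of `H` both of them are the given route. A choice of routes is an extension if and only if the
chosen routes pass some tests individually (the shape is orthogonal, the number of bends is
allowed, no foreign vertex is on the route) and in pairs (two routes meet in common ends only,
and the routes of the two orientations of an edge agree).
This is an instance of 2-SAT, and all coordinates that occur are coordinates of the input, so that
the tests are order comparisons between given rational numbers: two horizontal or vertical segments
are boxes, and meet if and only if the coordinate intervals do. `RepExtInstance.extensionTest_iff`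
states that the resulting Boolean function `extensionTest` is correct.

The criterion for 2-SAT is `exists_choice_iff`: there is a choice without conflicts unless some
literal and its opposite force one another. The forced literals are found by the algorithm of
Warshall for the transitive closure, on lists (`satisfiable_iff`).

For the running time, data are coded by binary trees, and `PolyTime f` states that a
structured program on four stacks of bits transforms the code of `x` into the code of `f x` in
polynomial time. The predicate is closed under composition, pairing, case distinction,
and the usual operations on lists; in a left fold the size of the state has to be controlled
(`PolyTime.foldl_of_growth`). This gives `PolyTime.extensionTest`, since rational
numbers are compared by comparing products of binary numbers. Structured programs compile to machines of
the type `Turing.TM2` step by step (`Prog.Run.steps`). The machine first moves its input word onto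
a work stack, where it becomes the tree code of the reversed word; a right-to-left parser, again a
left fold (`enc_parse_encode`), turns that into the data on which `extensionTest` works.
-/

/-! ### Structured programs on stacks of bits -/

/-- The four stacks of a structured program. -/
inductive Reg
  | main
  | left
  | right
  | count
  deriving DecidableEq

instance : Fintype Reg :=
  ⟨{.main, .left, .right, .count}, fun r => by cases r <;> simp⟩

/-- The contents of the four stacks, the top of each stack being the head of the list. -/
structure Store where
  main : List Bool
  left : List Bool
  right : List Bool
  count : List Bool

namespace Store

/-- The content of a stack. -/
def get (s : Store) : Reg → List Bool
  | .main => s.main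
  | .left => s.left
  | .right => s.right
  | .count => s.count

/-- Replace the content of a stack. -/
def set (s : Store) (r : Reg) (l : List Bool) : Store :=
  match r with
  | .main => { s with main := l }
  | .left => { s with left := l }
  | .right => { s with right := l }
  | .count => { s with count := l }

/-- The total number of bits on the stacks. -/
def size (s : Store) : ℕ :=
  s.main.length + s.left.length + s.right.length + s.count.length

end Store

/-- Structured programs on four stacks of bits. Tests inspect the top of a stack, `none` standing
for the empty stack. -/
inductive Prog
  | push (r : Reg) (b : Bool)
  | pop (r : Reg)
  | seq (p q : Prog)
  | ite (r : Reg) (c : Option Bool → Bool) (p q : Prog)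
  | loop (r : Reg) (c : Option Bool → Bool) (p : Prog)

namespace Prog

/-- `Run p s s' t`: started in `s`, the program `p` ends in `s'` after `t` elementary steps. -/
inductive Run : Prog → Store → Store → ℕ → Prop
  | push (r b s) : Run (push r b) s (s.set r (b :: s.get r)) 1
  | pop (r s) : Run (pop r) s (s.set r (s.get r).tail) 1
  | seq {p q s₁ s₂ s₃ t₁ t₂} : Run p s₁ s₂ t₁ → Run q s₂ s₃ t₂ → Run (seq p q) s₁ s₃ (t₁ + t₂)
  | ite_true {r c p q s s' t} : c (s.get r).head? = true → Run p s s' t →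
      Run (ite r c p q) s s' (1 + t)
  | ite_false {r c p q s s' t} : c (s.get r).head? = false → Run q s s' t →
      Run (ite r c p q) s s' (1 + t)
  | loop_exit {r c p s} : c (s.get r).head? = false → Run (loop r c p) s s 1
  | loop_step {r c p s₁ s₂ s₃ t₁ t₂} : c (s₁.get r).head? = true → Run p s₁ s₂ t₁ →
      Run (loop r c p) s₂ s₃ t₂ → Run (loop r c p) s₁ s₃ (1 + t₁ + t₂)

/-- A run pushes at most one bit in each step. -/
theorem Run.size_le {p : Prog} {s s' : Store} {t : ℕ} (h : Run p s s' t) :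
    s'.size ≤ s.size + t := by
  induction h with
  | push r b s => cases r <;> simp [Store.size, Store.set, Store.get] <;> omega
  | pop r s => cases r <;> simp [Store.size, Store.set, Store.get] <;> omega
  | _ => omega

/-! ### Compilation to Turing machines with several stacks -/

/-- The stacks of the compiled machine have the alphabet of the input on the input stack `none`
and bits on the others. -/
abbrev StackAlphabet : Option Reg → Type
  | none => Computability.Γ'
  | some _ => Bool

/-- The machine statements with labels in `Λ`; the internal state remembers the last symbol that
was inspected. -/
abbrev MStmt (Λ : Type) := Turing.TM2.Stmt StackAlphabet Λ (Option Computability.Γ')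

/-- The control points of a program. -/
def Label : Prog → Type
  | push _ _ => Unit
  | pop _ => Unit
  | seq p q => Label p ⊕ Label q
  | ite _ _ p q => Option (Label p ⊕ Label q)
  | loop _ _ p => Option (Label p)

/-- There are finitely many control points. -/
@[reducible]
def labelFintype : (p : Prog) → Fintype (Label p)
  | push _ _ => inferInstanceAs (Fintype Unit)
  | pop _ => inferInstanceAs (Fintype Unit)
  | seq p q =>
    letI := labelFintype p
    letI := labelFintype q
    inferInstanceAs (Fintype (Label p ⊕ Label q))
  | ite _ _ p q =>
    letI := labelFintype p
    letI := labelFintype q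
    inferInstanceAs (Fintype (Option (Label p ⊕ Label q)))
  | loop _ _ p =>
    letI := labelFintype p
    inferInstanceAs (Fintype (Option (Label p)))

instance (p : Prog) : Fintype (Label p) := labelFintype p

/-- The first control point. -/
def entry : (p : Prog) → Label p
  | push _ _ => ()
  | pop _ => ()
  | seq p _ => Sum.inl (entry p)
  | ite _ _ _ _ => none
  | loop _ _ _ => none

/-- Inspect the top of a stack of bits. -/
def look (r : Reg) {Λ : Type} (q : MStmt Λ) : MStmt Λ :=
  Turing.TM2.Stmt.peek (some r) (fun _ b => b.map Computability.Γ'.bit) q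

/-- The bit that the internal state remembers. -/
def seenBit : Option Computability.Γ' → Option Bool
  | some (Computability.Γ'.bit b) => some b
  | _ => none

/-- The machine statement at a control point of a program whose control points are placed into `Λ`
by `inj`, and which continues at `exit`. -/
def stmt {Λ : Type} : (p : Prog) → (inj : Label p → Λ) → (exit : Λ) → Label p → MStmt Λ
  | push r b, _, exit, _ => .push (some r) (fun _ => b) (.goto fun _ => exit)
  | pop r, _, exit, _ => .pop (some r) (fun v _ => v) (.goto fun _ => exit)
  | seq p q, inj, exit, l =>
    match l with
    | .inl l => stmt p (fun l => inj (.inl l)) (inj (.inr (entry q))) l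
    | .inr l => stmt q (fun l => inj (.inr l)) exit l
  | ite r c p q, inj, exit, l =>
    match l with
    | none => look r (.branch (fun v => c (seenBit v)) (.goto fun _ => inj (some (.inl (entry p))))
        (.goto fun _ => inj (some (.inr (entry q)))))
    | some (.inl l) => stmt p (fun l => inj (some (.inl l))) exit l
    | some (.inr l) => stmt q (fun l => inj (some (.inr l))) exit l
  | loop r c p, inj, exit, l =>
    match l with
    | none => look r (.branch (fun v => c (seenBit v)) (.goto fun _ => inj (some (entry p)))
        (.goto fun _ => exit))
    | some l => stmt p (fun l => inj (some l)) (inj none) l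

/-- The stacks of the machine in which the input stack holds `i`. -/
def contents (i : List Computability.Γ') (s : Store) : ∀ k, List (StackAlphabet k)
  | none => i
  | some r => s.get r

theorem update_contents (i : List Computability.Γ') (s : Store) (r : Reg) (l : List Bool) :
    Function.update (contents i s) (some r) l = contents i (s.set r l) := by
  funext k
  rcases k with _ | k
  · simp [contents]
  · cases r <;> cases k <;> simp [contents, Store.set, Store.get, Function.update]

/-- `c` is followed by `c'` after exactly `t` steps of the machine `M`. -/
def Steps {Λ : Type} (M : Λ → MStmt Λ) (t : ℕ)
    (c c' : Turing.TM2.Cfg StackAlphabet Λ (Option Computability.Γ')) : Prop :=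
  (flip bind (Turing.TM2.step M))^[t] (some c) = some c'

theorem Steps.trans {Λ : Type} {M : Λ → MStmt Λ} {t t' : ℕ}
    {c c' c'' : Turing.TM2.Cfg StackAlphabet Λ (Option Computability.Γ')}
    (h : Steps M t c c') (h' : Steps M t' c' c'') : Steps M (t + t') c c'' := by
  unfold Steps at *
  rw [add_comm, Function.iterate_add_apply, h, h']

theorem Steps.one {Λ : Type} {M : Λ → MStmt Λ} {l : Λ} {v : Option Computability.Γ'}
    {S : ∀ k, List (StackAlphabet k)} :
    Steps M 1 ⟨some l, v, S⟩ (Turing.TM2.stepAux (M l) v S) := rfl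

theorem seenBit_map (o : Option Bool) : seenBit (o.map Computability.Γ'.bit) = o := by
  cases o <;> rfl

/-- The compiled machine simulates the runs of the program, step by step. -/
theorem Run.steps {p : Prog} {s s' : Store} {t : ℕ} (h : Run p s s' t) {Λ : Type}
    {M : Λ → MStmt Λ} (i : List Computability.Γ') : ∀ (inj : Label p → Λ) (exit : Λ),
    (∀ l, M (inj l) = stmt p inj exit l) → ∀ v, ∃ v',
      Steps M t ⟨some (inj (entry p)), v, contents i s⟩ ⟨some exit, v', contents i s'⟩ := by
  induction h with
  | push r b s =>
    intro inj exit hM v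
    refine ⟨v, ?_⟩
    have := Steps.one (M := M) (l := inj (entry (Prog.push r b))) (v := v) (S := contents i s)
    rw [hM] at this
    simpa [stmt, update_contents, contents] using this
  | pop r s =>
    intro inj exit hM v
    refine ⟨v, ?_⟩
    have := Steps.one (M := M) (l := inj (entry (Prog.pop r))) (v := v) (S := contents i s)
    rw [hM] at this
    simpa [stmt, update_contents, contents] using this
  | @seq p q s₁ s₂ s₃ t₁ t₂ _ _ ih₁ ih₂ =>
    intro inj exit hM v
    obtain ⟨v₁, h₁⟩ := ih₁ (fun l => inj (.inl l)) (inj (.inr (entry q)))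
      (fun l => hM (.inl l)) v
    obtain ⟨v₂, h₂⟩ := ih₂ (fun l => inj (.inr l)) exit (fun l => hM (.inr l)) v₁
    exact ⟨v₂, h₁.trans h₂⟩
  | @ite_true r c p q s s' t hc _ ih =>
    intro inj exit hM v
    have h₁ := Steps.one (M := M) (l := inj (entry (ite r c p q))) (v := v) (S := contents i s)
    rw [hM] at h₁
    simp only [entry, stmt, look, contents, Turing.TM2.stepAux, seenBit_map, hc, cond_true] at h₁
    obtain ⟨v', h₂⟩ := ih (fun l => inj (some (.inl l))) exit (fun l => hM (some (.inl l))) _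
    exact ⟨v', h₁.trans h₂⟩
  | @ite_false r c p q s s' t hc _ ih =>
    intro inj exit hM v
    have h₁ := Steps.one (M := M) (l := inj (entry (ite r c p q))) (v := v) (S := contents i s)
    rw [hM] at h₁
    simp only [entry, stmt, look, contents, Turing.TM2.stepAux, seenBit_map, hc, cond_false] at h₁
    obtain ⟨v', h₂⟩ := ih (fun l => inj (some (.inr l))) exit (fun l => hM (some (.inr l))) _
    exact ⟨v', h₁.trans h₂⟩
  | @loop_exit r c p s hc =>
    intro inj exit hM v
    have h₁ := Steps.one (M := M) (l := inj (entry (loop r c p))) (v := v) (S := contents i s)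
    rw [hM] at h₁
    simp only [entry, stmt, look, contents, Turing.TM2.stepAux, seenBit_map, hc, cond_false] at h₁
    exact ⟨_, h₁⟩
  | @loop_step r c p s₁ s₂ s₃ t₁ t₂ hc _ _ ih₁ ih₂ =>
    intro inj exit hM v
    have h₁ := Steps.one (M := M) (l := inj (entry (loop r c p))) (v := v) (S := contents i s₁)
    rw [hM] at h₁
    simp only [entry, stmt, look, contents, Turing.TM2.stepAux, seenBit_map, hc, cond_true] at h₁
    obtain ⟨v₁, h₂⟩ := ih₁ (fun l => inj (some l)) (inj none) (fun l => hM (some l)) _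
    obtain ⟨v₂, h₃⟩ := ih₂ inj exit hM v₁
    exact ⟨v₂, (h₁.trans h₂).trans h₃⟩

end Prog

/-! ### Binary trees as data -/

/-- Binary trees, the values on which programs compute. -/
inductive BTree
  | nil
  | cons (x y : BTree)

namespace BTree

/-- Prefix code of a tree. The code of `cons x y` is the code of `x` on top of that of `y`, under
one more bit. -/
def code : BTree → List Bool
  | nil => [false]
  | cons x y => true :: (code x ++ code y)

/-- The length of the code. -/
def size (x : BTree) : ℕ := x.code.length

@[simp] theorem size_nil : nil.size = 1 := rfl

@[simp] theorem size_cons (x y : BTree) : (cons x y).size = x.size + y.size + 1 := by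
  simp [size, code]

theorem code_append_inj {x y : BTree} {l l' : List Bool} (h : x.code ++ l = y.code ++ l') :
    x = y ∧ l = l' := by
  induction x generalizing y l l' with
  | nil => cases y <;> simp_all [code]
  | cons a b iha ihb =>
    cases y with
    | nil => simp [code] at h
    | cons c d =>
      simp only [code, List.cons_append, List.append_assoc, List.cons.injEq, true_and] at h
      obtain ⟨h₁, h⟩ := iha h
      obtain ⟨h₂, h⟩ := ihb h
      exact ⟨by rw [h₁, h₂], h⟩

theorem code_injective : Function.Injective code := fun x y h =>
  (code_append_inj (l := []) (l' := []) (by simpa using h)).1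

end BTree

/-! ### Elementary programs on trees -/

namespace Prog

theorem Run.cast {p : Prog} {s s' s'' : Store} {t t' : ℕ} (h : Run p s s' t) (hs : s' = s'')
    (ht : t = t') : Run p s s'' t' := hs ▸ ht ▸ h

/-- `p` leads from `s` to `s'` within time `T`. -/
def RunLE (p : Prog) (s s' : Store) (T : ℕ) : Prop := ∃ t ≤ T, Run p s s' t

theorem Run.le {p : Prog} {s s' : Store} {t T : ℕ} (h : Run p s s' t) (ht : t ≤ T) :
    RunLE p s s' T := ⟨t, ht, h⟩

theorem RunLE.mono {p : Prog} {s s' : Store} {T T' : ℕ} (h : RunLE p s s' T) (hT : T ≤ T') :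
    RunLE p s s' T' := let ⟨t, ht, h⟩ := h; ⟨t, ht.trans hT, h⟩

theorem RunLE.seq {p q : Prog} {s₁ s₂ s₃ : Store} {T₁ T₂ : ℕ} (h₁ : RunLE p s₁ s₂ T₁)
    (h₂ : RunLE q s₂ s₃ T₂) : RunLE (.seq p q) s₁ s₃ (T₁ + T₂) :=
  let ⟨t₁, ht₁, h₁⟩ := h₁
  let ⟨t₂, ht₂, h₂⟩ := h₂
  ⟨t₁ + t₂, Nat.add_le_add ht₁ ht₂, .seq h₁ h₂⟩

theorem RunLE.ite_true {r : Reg} {c : Option Bool → Bool} {p q : Prog} {s s' : Store} {T : ℕ}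
    (hc : c (s.get r).head? = true) (h : RunLE p s s' T) : RunLE (.ite r c p q) s s' (1 + T) :=
  let ⟨t, ht, h⟩ := h; ⟨1 + t, Nat.add_le_add_left ht 1, .ite_true hc h⟩

theorem RunLE.ite_false {r : Reg} {c : Option Bool → Bool} {p q : Prog} {s s' : Store} {T : ℕ}
    (hc : c (s.get r).head? = false) (h : RunLE q s s' T) : RunLE (.ite r c p q) s s' (1 + T) :=
  let ⟨t, ht, h⟩ := h; ⟨1 + t, Nat.add_le_add_left ht 1, .ite_false hc h⟩

theorem RunLE.loop_step {r : Reg} {c : Option Bool → Bool} {p : Prog} {s₁ s₂ s₃ : Store}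
    {T₁ T₂ : ℕ} (hc : c (s₁.get r).head? = true) (h₁ : RunLE p s₁ s₂ T₁)
    (h₂ : RunLE (.loop r c p) s₂ s₃ T₂) : RunLE (.loop r c p) s₁ s₃ (1 + T₁ + T₂) :=
  let ⟨t₁, ht₁, h₁⟩ := h₁
  let ⟨t₂, ht₂, h₂⟩ := h₂
  ⟨1 + t₁ + t₂, by omega, .loop_step hc h₁ h₂⟩

/-- Test for the bit `b` on top. -/
def isTop (b : Bool) (o : Option Bool) : Bool := o == some b

/-- Empty the stack `r`. -/
def clear (r : Reg) : Prog := loop r Option.isSome (pop r)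

/-- Move the stack `r` onto the stack `r'`, bit by bit. -/
def transfer (r r' : Reg) : Prog :=
  loop r Option.isSome
    (ite r (isTop true) (seq (pop r) (push r' true)) (seq (pop r) (push r' false)))

/-- Move the tree on top of the main stack onto the stack `r`, bit by bit. The length of the
counter is the number of trees that are still to be read. -/
def grab (r : Reg) : Prog :=
  seq (push .count true) (loop .count Option.isSome
    (ite .main (isTop true) (seq (pop .main) (seq (push r true) (push .count true)))
      (seq (pop .main) (seq (push r false) (pop .count)))))

theorem run_clear_left (m l r c : List Bool) :
    Run (clear .left) ⟨m, l, r, c⟩ ⟨m, [], r, c⟩ (2 * l.length + 1) := by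
  induction l with
  | nil => exact .loop_exit rfl
  | cons b l ih =>
    exact (Run.loop_step (s₂ := ⟨m, l, r, c⟩) (t₁ := 1) rfl (.pop .left _) ih).cast rfl
      (by simp; ring)

theorem run_clear_count (m l r c : List Bool) :
    Run (clear .count) ⟨m, l, r, c⟩ ⟨m, l, r, []⟩ (2 * c.length + 1) := by
  induction c with
  | nil => exact .loop_exit rfl
  | cons b c ih =>
    exact (Run.loop_step (s₂ := ⟨m, l, r, c⟩) (t₁ := 1) rfl (.pop .count _) ih).cast rfl
      (by simp; ring)

theorem run_transfer_left_main (m l r c : List Bool) :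
    Run (transfer .left .main) ⟨m, l, r, c⟩ ⟨l.reverse ++ m, [], r, c⟩ (4 * l.length + 1) := by
  induction l generalizing m with
  | nil => exact .loop_exit rfl
  | cons b l ih =>
    refine (Run.loop_step (s₂ := ⟨b :: m, l, r, c⟩) (t₁ := 3) rfl ?_ (ih _)).cast
      (by simp) (by simp; ring)
    cases b
    · exact .ite_false rfl (.seq (.pop .left _) (.push .main _ _))
    · exact .ite_true rfl (.seq (.pop .left _) (.push .main _ _))

theorem run_transfer_right_main (m l r c : List Bool) :
    Run (transfer .right .main) ⟨m, l, r, c⟩ ⟨r.reverse ++ m, l, [], c⟩ (4 * r.length + 1) := by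
  induction r generalizing m with
  | nil => exact .loop_exit rfl
  | cons b r ih =>
    refine (Run.loop_step (s₂ := ⟨b :: m, l, r, c⟩) (t₁ := 3) rfl ?_ (ih _)).cast
      (by simp) (by simp; ring)
    cases b
    · exact .ite_false rfl (.seq (.pop .right _) (.push .main _ _))
    · exact .ite_true rfl (.seq (.pop .right _) (.push .main _ _))

theorem run_transfer_right_left (m l r c : List Bool) :
    Run (transfer .right .left) ⟨m, l, r, c⟩ ⟨m, r.reverse ++ l, [], c⟩ (4 * r.length + 1) := by
  induction r generalizing l with
  | nil => exact .loop_exit rfl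
  | cons b r ih =>
    refine (Run.loop_step (s₂ := ⟨m, b :: l, r, c⟩) (t₁ := 3) rfl ?_ (ih _)).cast
      (by simp) (by simp; ring)
    cases b
    · exact .ite_false rfl (.seq (.pop .right _) (.push .left _ _))
    · exact .ite_true rfl (.seq (.pop .right _) (.push .left _ _))

theorem run_grab_left (x : BTree) (m r : List Bool) :
    Run (grab .left) ⟨x.code ++ m, [], r, []⟩ ⟨m, x.code.reverse, r, []⟩ (5 * x.size + 2) := by
  suffices H : ∀ (x : BTree) (m l c : List Bool) (s : Store) (t : ℕ),
      Run (loop .count Option.isSome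
        (ite .main (isTop true) (seq (pop .main) (seq (push .left true) (push .count true)))
          (seq (pop .main) (seq (push .left false) (pop .count)))))
        ⟨m, x.code.reverse ++ l, r, c⟩ s t →
      Run (loop .count Option.isSome
        (ite .main (isTop true) (seq (pop .main) (seq (push .left true) (push .count true)))
          (seq (pop .main) (seq (push .left false) (pop .count)))))
        ⟨x.code ++ m, l, r, true :: c⟩ s (5 * x.size + t) by
    have h := H x m [] [] _ _ (.loop_exit rfl)
    exact (Run.seq (.push .count true _) h).cast (by simp) (by ring)
  intro x
  induction x with
  | nil =>
    intro m l c s t h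
    exact (Run.loop_step rfl (.ite_false rfl
      (.seq (.pop .main _) (.seq (.push .left _ _) (.pop .count _)))) h).cast rfl (by simp)
  | cons x y ihx ihy =>
    intro m l c s t h
    have h₁ := ihx (y.code ++ m) (true :: l) (true :: c) s (5 * y.size + t)
      (ihy _ _ _ _ _ (by simpa [BTree.code] using h))
    have h₂ := Run.loop_step (s₁ := ⟨true :: (x.code ++ (y.code ++ m)), l, r, true :: c⟩)
      (s₂ := ⟨x.code ++ (y.code ++ m), true :: l, r, true :: true :: c⟩) rfl
      (.ite_true rfl
        (.seq (.pop .main _) (.seq (.push .left _ _) (.push .count _ _)))) h₁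
    simpa [BTree.code] using h₂.cast rfl (by simp; ring)

theorem run_grab_right (x : BTree) (m l : List Bool) :
    Run (grab .right) ⟨x.code ++ m, l, [], []⟩ ⟨m, l, x.code.reverse, []⟩ (5 * x.size + 2) := by
  suffices H : ∀ (x : BTree) (m r c : List Bool) (s : Store) (t : ℕ),
      Run (loop .count Option.isSome
        (ite .main (isTop true) (seq (pop .main) (seq (push .right true) (push .count true)))
          (seq (pop .main) (seq (push .right false) (pop .count)))))
        ⟨m, l, x.code.reverse ++ r, c⟩ s t →
      Run (loop .count Option.isSome
        (ite .main (isTop true) (seq (pop .main) (seq (push .right true) (push .count true)))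
          (seq (pop .main) (seq (push .right false) (pop .count)))))
        ⟨x.code ++ m, l, r, true :: c⟩ s (5 * x.size + t) by
    have h := H x m [] [] _ _ (.loop_exit rfl)
    exact (Run.seq (.push .count true _) h).cast (by simp) (by ring)
  intro x
  induction x with
  | nil =>
    intro m r c s t h
    exact (Run.loop_step rfl (.ite_false rfl
      (.seq (.pop .main _) (.seq (.push .right _ _) (.pop .count _)))) h).cast rfl (by simp)
  | cons x y ihx ihy =>
    intro m r c s t h
    have h₁ := ihx (y.code ++ m) (true :: r) (true :: c) s (5 * y.size + t)
      (ihy _ _ _ _ _ (by simpa [BTree.code] using h))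
    have h₂ := Run.loop_step (s₁ := ⟨true :: (x.code ++ (y.code ++ m)), l, r, true :: c⟩)
      (s₂ := ⟨x.code ++ (y.code ++ m), l, true :: r, true :: true :: c⟩) rfl
      (.ite_true rfl
        (.seq (.pop .main _) (.seq (.push .right _ _) (.push .count _ _)))) h₁
    simpa [BTree.code] using h₂.cast rfl (by simp; ring)

/-- A store with an arbitrary main stack, the other stacks being empty. -/
abbrev mainOnly (l : List Bool) : Store := ⟨l, [], [], []⟩

/-- Remove the tree on top. -/
def drop : Prog := seq (grab .left) (clear .left)

/-- Exchange the two trees on top. -/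
def swap : Prog :=
  seq (grab .left) (seq (grab .right) (seq (transfer .left .main) (transfer .right .main)))

/-- Move the left stack onto both the main and the right stack. -/
def spread : Prog :=
  loop .left Option.isSome (ite .left (isTop true)
    (seq (pop .left) (seq (push .main true) (push .right true)))
    (seq (pop .left) (seq (push .main false) (push .right false))))

/-- Duplicate the tree on top. -/
def dup : Prog :=
  seq (grab .left) (seq spread (seq (transfer .right .left) (transfer .left .main)))

theorem run_drop (x : BTree) (m : List Bool) :
    RunLE drop (mainOnly (x.code ++ m)) (mainOnly m) (7 * x.size + 3) :=
  (Run.seq (run_grab_left x m []) (run_clear_left _ _ _ _)).le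
    (by simp [BTree.size]; omega)

theorem run_swap (x y : BTree) (m : List Bool) :
    RunLE swap (mainOnly (x.code ++ (y.code ++ m))) (mainOnly (y.code ++ (x.code ++ m)))
      (9 * (x.size + y.size) + 6) :=
  ((Run.seq (run_grab_left x _ []) (.seq (run_grab_right y _ _)
    (.seq (run_transfer_left_main _ _ _ _) (run_transfer_right_main _ _ _ _)))).cast
      (by simp) rfl).le (by simp [BTree.size]; omega)

theorem run_spread (m l r c : List Bool) :
    Run spread ⟨m, l, r, c⟩ ⟨l.reverse ++ m, [], l.reverse ++ r, c⟩ (5 * l.length + 1) := by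
  induction l generalizing m r with
  | nil => exact .loop_exit rfl
  | cons b l ih =>
    refine (Run.loop_step (s₂ := ⟨b :: m, l, b :: r, c⟩) (t₁ := 4) rfl ?_ (ih _ _)).cast
      (by simp) (by simp; ring)
    cases b
    · exact .ite_false rfl (.seq (.pop .left _) (.seq (.push .main _ _) (.push .right _ _)))
    · exact .ite_true rfl (.seq (.pop .left _) (.seq (.push .main _ _) (.push .right _ _)))

theorem run_dup (x : BTree) (m : List Bool) :
    RunLE dup (mainOnly (x.code ++ m)) (mainOnly (x.code ++ (x.code ++ m)))
      (18 * x.size + 5) :=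
  ((Run.seq (run_grab_left x _ []) (.seq (run_spread _ _ _ _)
    (.seq (run_transfer_right_left _ _ _ _) (run_transfer_left_main _ _ _ _)))).cast
      (by simp) rfl).le (by simp [BTree.size]; omega)

/-- Compare the left and the right stack. At the end, the right stack and the counter are both
empty if and only if the stacks were equal. -/
def compare : Prog :=
  loop .left Option.isSome (seq
    (ite .left (isTop true)
      (ite .right (isTop true) (pop .right) (push .count true))
      (ite .right (isTop false) (pop .right) (push .count true)))
    (pop .left))

theorem run_compare (m l r c : List Bool) : ∃ r' c' : List Bool,
    RunLE compare ⟨m, l, r, c⟩ ⟨m, [], r', c'⟩ (5 * l.length + 1) ∧ r'.length ≤ r.length ∧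
      c'.length ≤ c.length + l.length ∧ (r' = [] ∧ c' = [] ↔ c = [] ∧ l = r) := by
  induction l generalizing r c with
  | nil => exact ⟨r, c, (Run.loop_exit rfl).le le_rfl, le_rfl, le_rfl, by
      constructor <;> rintro ⟨rfl, rfl⟩ <;> exact ⟨rfl, rfl⟩⟩
  | cons b l ih =>
    by_cases hb : r.head? = some b
    · obtain ⟨r, rfl⟩ : ∃ r₁, r = b :: r₁ := by
        cases r <;> simp_all
      obtain ⟨r', c', h, hr, hc, hiff⟩ := ih r c
      refine ⟨r', c', (RunLE.loop_step (s₂ := ⟨m, l, r, c⟩) (T₁ := 4) rfl ?_ h).mono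
        (by simp; omega), by simp; omega, by simp; omega, by simpa using hiff⟩
      cases b
      · exact (Run.seq (.ite_false rfl (.ite_true rfl (.pop .right _))) (.pop .left _)).le
          (by simp)
      · exact (Run.seq (.ite_true rfl (.ite_true rfl (.pop .right _))) (.pop .left _)).le
          (by simp)
    · obtain ⟨r', c', h, hr, hc, hiff⟩ := ih r (true :: c)
      refine ⟨r', c', (RunLE.loop_step (s₂ := ⟨m, l, r, true :: c⟩) (T₁ := 4) rfl ?_ h).mono
        (by simp; omega), hr, by simp at hc ⊢; omega, ?_⟩
      · have hr' : isTop b r.head? = false := by simpa [isTop] using hb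
        cases b
        · exact (Run.seq (.ite_false rfl (.ite_false hr' (.push .count _ _))) (.pop .left _)).le
            (by simp)
        · exact (Run.seq (.ite_true rfl (.ite_false hr' (.push .count _ _))) (.pop .left _)).le
            (by simp)
      · rw [hiff]
        simp only [reduceCtorEq, false_and, false_iff, not_and]
        rintro rfl rfl
        simp at hb

/-- Empty the right stack, pushing one bit onto the counter for each bit removed. -/
def tally : Prog :=
  loop .right Option.isSome (seq (pop .right) (push .count true))

theorem run_tally (m l r c : List Bool) :
    Run tally ⟨m, l, r, c⟩ ⟨m, l, [], List.replicate r.length true ++ c⟩ (3 * r.length + 1) := by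
  induction r generalizing c with
  | nil => exact .loop_exit rfl
  | cons b r ih =>
    refine (Run.loop_step (s₂ := ⟨m, l, r, true :: c⟩) (t₁ := 2) rfl
      (.seq (.pop .right _) (.push .count _ _)) (ih _)).cast ?_ (by simp; ring)
    simp only [List.length_cons, List.replicate_succ', List.append_assoc, List.cons_append,
      List.nil_append]

end Prog

namespace BTree

/-- Truth values as trees. -/
def ofBool : Bool → BTree
  | false => nil
  | true => cons nil nil

end BTree

namespace Prog

/-- Replace the two trees on top by the truth value of their equality. -/
def equal : Prog :=
  seq (grab .left) (seq (grab .right) (seq compare (seq tally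
    (ite .count Option.isSome (seq (clear .count) (push .main false))
      (seq (push .main false) (seq (push .main false) (push .main true)))))))

open Classical in
theorem run_equal (x y : BTree) (m : List Bool) :
    RunLE equal (mainOnly (x.code ++ (y.code ++ m)))
      (mainOnly ((BTree.ofBool (decide (x = y))).code ++ m))
      (20 * (x.size + y.size) + 20) := by
  obtain ⟨r', c', h, hr, hc, hiff⟩ := run_compare m x.code.reverse y.code.reverse []
  have hxy : r' = [] ∧ c' = [] ↔ x = y := by
    rw [hiff]; simp [BTree.code_injective.eq_iff]
  have h₁ := ((run_grab_left x (y.code ++ m) []).le le_rfl).seq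
    (((run_grab_right y m _).le le_rfl).seq (h.seq (((run_tally _ _ _ _).le le_rfl).seq
    (T₂ := 2 * (x.size + y.size) + 8) (q := (ite .count Option.isSome
      (seq (clear .count) (push .main false))
      (seq (push .main false) (seq (push .main false) (push .main true)))))
    (s₃ := (mainOnly ((BTree.ofBool (decide (x = y))).code ++ m))) ?_)))
  · refine h₁.mono ?_
    simp [BTree.size] at *
    omega
  · by_cases e : x = y
    · obtain ⟨rfl, rfl⟩ := hxy.2 e
      simp only [e, decide_true]
      exact (Run.ite_false rfl (.seq (.push .main _ _) (.seq (.push .main _ _)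
        (.push .main _ _)))).le (by omega)
    · simp only [e, decide_false]
      have hne : (List.replicate r'.length true ++ c').length ≠ 0 := by
        intro h0
        simp at h0
        exact e (hxy.1 h0)
      refine (Run.ite_true (s := ⟨m, [], [], _⟩) ?_
        (.seq (run_clear_count _ _ _ _) (.push .main _ _))).le ?_
      · cases hl : List.replicate r'.length true ++ c' with
        | nil => simp [hl] at hne
        | cons a l => rfl
      · simp [BTree.size] at *
        omega

end Prog

/-! ### Polynomial-time functions between types of tree-coded objects -/

/-- A type whose elements are coded by trees. -/
class TreeEnc (α : Type) where
  enc : α → BTree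
  enc_injective : Function.Injective enc

/-- The length of the code of an object. -/
def encSize {α : Type} [TreeEnc α] (a : α) : ℕ := (TreeEnc.enc a).size

/-- A function is computable in polynomial time if some program replaces the code of any argument,
on top of the main stack, by the code of the value, within a time that is polynomial in the length
of the code of the argument. -/
@[fun_prop]
def PolyTime {α β : Type} [TreeEnc α] [TreeEnc β] (f : α → β) : Prop :=
  ∃ (P : Prog) (p : Polynomial ℕ), ∀ a m,
    Prog.RunLE P (Prog.mainOnly ((TreeEnc.enc a).code ++ m))
      (Prog.mainOnly ((TreeEnc.enc (f a)).code ++ m)) (p.eval (encSize a))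

theorem Polynomial.eval_nat_mono (p : Polynomial ℕ) : Monotone fun n => p.eval n := by
  intro m n h
  simp only [Polynomial.eval_eq_sum, Polynomial.sum]
  gcongr

instance : TreeEnc Bool :=
  ⟨BTree.ofBool, fun a b h => by cases a <;> cases b <;> simp_all [BTree.ofBool]⟩

instance {α β : Type} [TreeEnc α] [TreeEnc β] : TreeEnc (α × β) :=
  ⟨fun p => .cons (TreeEnc.enc p.1) (TreeEnc.enc p.2), fun p q h => by
    injection h with h₁ h₂
    exact Prod.ext (TreeEnc.enc_injective h₁) (TreeEnc.enc_injective h₂)⟩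

/-- A list is coded by a right comb. -/
def encList {α : Type} [TreeEnc α] : List α → BTree
  | [] => .nil
  | a :: l => .cons (TreeEnc.enc a) (encList l)

instance {α : Type} [TreeEnc α] : TreeEnc (List α) :=
  ⟨encList, fun l => by
    induction l with
    | nil => intro l' h; cases l' <;> simp_all [encList]
    | cons a l ih =>
      intro l' h
      cases l' with
      | nil => simp [encList] at h
      | cons b l' =>
        injection h with h₁ h₂
        rw [TreeEnc.enc_injective h₁, ih h₂]⟩

/-- Comb with the given number of teeth. -/
def combOfNat : ℕ → BTree
  | 0 => .nil
  | n + 1 => .cons .nil (combOfNat n)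

theorem combOfNat_injective : Function.Injective combOfNat := by
  intro m
  induction m with
  | zero => intro n h; cases n <;> simp_all [combOfNat]
  | succ m ih =>
    intro n h
    cases n with
    | zero => simp [combOfNat] at h
    | succ n =>
      injection h with _ h
      rw [ih h]

/-- Numbering of the symbols of the input alphabet. -/
def symbolIndex : Computability.Γ' → ℕ
  | .blank => 0
  | .bit false => 1
  | .bit true => 2
  | .bra => 3
  | .ket => 4
  | .comma => 5

instance : TreeEnc Computability.Γ' :=
  ⟨fun a => combOfNat (symbolIndex a), combOfNat_injective.comp (by
    rintro (_ | _ | _) (_ | _ | _) h <;> simp_all [symbolIndex] <;>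
    (rename_i a; cases a <;> simp_all) <;>
    (rename_i a; cases a <;> simp_all))⟩

section encSize

variable {α β : Type} [TreeEnc α] [TreeEnc β]

@[simp] theorem encSize_prod (p : α × β) : encSize p = encSize p.1 + encSize p.2 + 1 :=
  BTree.size_cons _ _

@[simp] theorem encSize_nil : encSize ([] : List α) = 1 := rfl

@[simp] theorem encSize_cons (a : α) (l : List α) :
    encSize (a :: l) = encSize a + encSize l + 1 := BTree.size_cons _ _

theorem encSize_bool (b : Bool) : encSize b ≤ 3 := by cases b <;> decide

theorem length_le_encSize (l : List α) : l.length ≤ encSize l := by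
  induction l with
  | nil => simp
  | cons a l ih => simp; omega

theorem encSize_le_of_mem {a : α} {l : List α} (h : a ∈ l) : encSize a ≤ encSize l := by
  induction l with
  | nil => simp at h
  | cons b l ih =>
    rcases List.mem_cons.1 h with rfl | h
    · simp; omega
    · have := ih h
      simp; omega

theorem encSize_le_of_sublist {l l' : List α} (h : l.Sublist l') : encSize l ≤ encSize l' := by
  induction h with
  | slnil => exact le_rfl
  | cons a _ ih => simp; omega
  | cons_cons a _ ih => simp; omega

end encSize

namespace PolyTime

open Polynomial

variable {α β γ σ : Type} [TreeEnc α] [TreeEnc β] [TreeEnc γ] [TreeEnc σ]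

theorem eval_le {p : Polynomial ℕ} {m n : ℕ} (h : m ≤ n) : p.eval m ≤ p.eval n :=
  Polynomial.eval_nat_mono p h

/-- Values of polynomial-time functions have polynomially bounded length. -/
theorem exists_size_le {f : α → β} (hf : PolyTime f) :
    ∃ q : Polynomial ℕ, ∀ a, encSize (f a) ≤ q.eval (encSize a) := by
  obtain ⟨P, p, h⟩ := hf
  refine ⟨X + p, fun a => ?_⟩
  obtain ⟨t, ht, h⟩ := h a []
  have := h.size_le
  simp [Store.size] at this
  simp [encSize, BTree.size] at *
  omega

/-- A function that does not change codes is computable by doing nothing. -/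
theorem of_enc_eq {f : α → β} (h : ∀ a, TreeEnc.enc (f a) = TreeEnc.enc a) : PolyTime f :=
  ⟨.seq (.push .count true) (.pop .count), 2, fun a m => by
    rw [h]
    exact (Prog.Run.seq (.push .count true _) (.pop .count _)).le (by simp)⟩

@[fun_prop]
theorem id' : PolyTime fun a : α => a := of_enc_eq fun _ => rfl

@[fun_prop]
theorem comp {g : β → γ} {f : α → β} (hg : PolyTime g) (hf : PolyTime f) :
    PolyTime fun a => g (f a) := by
  obtain ⟨Q, hQ⟩ := hf.exists_size_le
  obtain ⟨P, p, hf⟩ := hf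
  obtain ⟨P', p', hg⟩ := hg
  refine ⟨.seq P P', p + p'.comp Q, fun a m => ((hf a m).seq (hg (f a) m)).mono ?_⟩
  simp only [eval_add, eval_comp]
  gcongr
  exact eval_le (hQ a)

/-- Push the bits of a list, the last one first. -/
def _root_.Prog.pushes : List Bool → Prog
  | [] => .seq (.push .count true) (.pop .count)
  | b :: l => .seq (Prog.pushes l) (.push .main b)

theorem run_pushes (l m : List Bool) : Prog.RunLE (Prog.pushes l) (Prog.mainOnly m)
    (Prog.mainOnly (l ++ m)) (l.length + 2) := by
  induction l with
  | nil => exact (Prog.Run.seq (.push .count true _) (.pop .count _)).le (by simp)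
  | cons b l ih => exact (ih.seq ((Prog.Run.push .main b _).le le_rfl)).mono (by simp)

@[fun_prop]
theorem const (b : β) : PolyTime fun _ : α => b := by
  refine ⟨.seq .drop (.pushes (TreeEnc.enc b).code),
    7 * X + C (3 + ((TreeEnc.enc b).code.length + 2)),
    fun a m => ((Prog.run_drop _ m).seq (run_pushes _ m)).mono ?_⟩
  simp only [encSize, eval_add, eval_mul, eval_X, eval_C, eval_ofNat]
  omega

@[fun_prop]
theorem prodMk {f : α → β} {g : α → γ} (hf : PolyTime f) (hg : PolyTime g) :
    PolyTime fun a => (f a, g a) := by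
  obtain ⟨Q, hQ⟩ := hf.exists_size_le
  obtain ⟨Q', hQ'⟩ := hg.exists_size_le
  obtain ⟨P, p, hf⟩ := hf
  obtain ⟨P', p', hg⟩ := hg
  refine ⟨.seq .dup (.seq P (.seq .swap (.seq P' (.seq .swap (.push .main true))))),
    18 * X + 9 * (Q + X) + 9 * (Q' + Q) + p + p' + C 18, fun a m => ?_⟩
  refine ((Prog.run_dup (TreeEnc.enc a) m).seq ((hf a _).seq ((Prog.run_swap _ _ m).seq
    ((hg a _).seq ((Prog.run_swap (TreeEnc.enc (g a)) (TreeEnc.enc (f a)) m).seq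
    (.mono (T' := 1) ?_ le_rfl)))))).mono ?_
  · refine (Prog.Run.cast (Prog.Run.push .main true _) ?_ rfl).le le_rfl
    simp [Store.set, Store.get, TreeEnc.enc, BTree.code]
  · have h₁ := hQ a
    have h₂ := hQ' a
    simp only [encSize, eval_add, eval_mul, eval_X, eval_C, eval_ofNat] at *
    omega

theorem code_prod (p : α × β) (m : List Bool) : (TreeEnc.enc p).code ++ m =
    true :: ((TreeEnc.enc p.1).code ++ ((TreeEnc.enc p.2).code ++ m)) := by
  simp [TreeEnc.enc, BTree.code]

@[fun_prop]
theorem snd' : PolyTime fun p : α × β => p.2 := by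
  refine ⟨.seq (.pop .main) .drop, 7 * X + C 4, fun p m => ?_⟩
  rw [code_prod]
  refine (((Prog.Run.pop .main _).le le_rfl).seq
    (Prog.run_drop (TreeEnc.enc p.1) ((TreeEnc.enc p.2).code ++ m))).mono ?_
  have h := encSize_prod p
  simp only [encSize, eval_add, eval_mul, eval_X, eval_C, eval_ofNat] at *
  omega

@[fun_prop]
theorem fst' : PolyTime fun p : α × β => p.1 := by
  refine ⟨.seq (.pop .main) (.seq .swap .drop), 16 * X + C 10, fun p m => ?_⟩
  rw [code_prod]
  refine (((Prog.Run.pop .main _).le le_rfl).seq ((Prog.run_swap _ _ m).seq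
    (Prog.run_drop (TreeEnc.enc p.2) ((TreeEnc.enc p.1).code ++ m)))).mono ?_
  have h := encSize_prod p
  simp only [encSize, eval_add, eval_mul, eval_X, eval_C, eval_ofNat] at *
  omega

@[fun_prop]
theorem fst {f : α → β × γ} (hf : PolyTime f) : PolyTime fun a => (f a).1 := fst'.comp hf

@[fun_prop]
theorem snd {f : α → β × γ} (hf : PolyTime f) : PolyTime fun a => (f a).2 := snd'.comp hf

/-- Equality of objects is equality of the codes. -/
@[fun_prop]
theorem decide_eq {f g : α → β} [DecidablePred fun a => f a = g a] (hf : PolyTime f)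
    (hg : PolyTime g) : PolyTime fun a => decide (f a = g a) := by
  classical
  suffices h : PolyTime fun p : β × β => decide (p.1 = p.2) by
    convert h.comp (hf.prodMk hg)
  refine ⟨.seq (.pop .main) .equal, 20 * X + C 21, fun p m => ?_⟩
  rw [code_prod]
  refine (((Prog.Run.pop .main _).le le_rfl).seq (?_ : Prog.RunLE _
    (Prog.mainOnly ((TreeEnc.enc p.1).code ++ ((TreeEnc.enc p.2).code ++ m))) _ _)).mono
    (T := 1 + (20 * (encSize p.1 + encSize p.2) + 20)) ?_
  · have h := Prog.run_equal (TreeEnc.enc p.1) (TreeEnc.enc p.2) m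
    rwa [decide_eq_decide.2 TreeEnc.enc_injective.eq_iff] at h
  · simp only [encSize_prod, eval_add, eval_mul, eval_X, eval_C, eval_ofNat]
    omega

/-- The program that runs one of two programs, according to the truth value on top, which is
removed. -/
def _root_.Prog.choose (P Q : Prog) : Prog :=
  .ite .main (Prog.isTop true) (.seq (.pop .main) (.seq (.pop .main) (.seq (.pop .main) P)))
    (.seq (.pop .main) Q)

theorem run_choose {P Q : Prog} {b : Bool} {m : List Bool} {s : Store} {T : ℕ}
    (hP : b = true → Prog.RunLE P (Prog.mainOnly m) s T)
    (hQ : b = false → Prog.RunLE Q (Prog.mainOnly m) s T) :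
    Prog.RunLE (.choose P Q) (Prog.mainOnly ((TreeEnc.enc b).code ++ m)) s (T + 4) := by
  cases b
  · exact (Prog.RunLE.ite_false rfl (.seq ((Prog.Run.pop .main _).le le_rfl) (hQ rfl))).mono
      (by omega)
  · exact (Prog.RunLE.ite_true rfl (.seq ((Prog.Run.pop .main _).le le_rfl)
      (.seq ((Prog.Run.pop .main _).le le_rfl) (.seq ((Prog.Run.pop .main _).le le_rfl)
      (hP rfl))))).mono (by omega)

@[fun_prop]
theorem cond {c : α → Bool} {f g : α → β} (hc : PolyTime c) (hf : PolyTime f) (hg : PolyTime g) :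
    PolyTime fun a => bif c a then f a else g a := by
  obtain ⟨P, p, hc⟩ := hc
  obtain ⟨Pf, pf, hf⟩ := hf
  obtain ⟨Pg, pg, hg⟩ := hg
  refine ⟨.seq .dup (.seq P (.choose Pf Pg)), 18 * X + p + pf + pg + C 9, fun a m => ?_⟩
  refine ((Prog.run_dup _ m).seq ((hc a _).seq (run_choose (T := (pf + pg).eval (encSize a))
    ?_ ?_))).mono ?_
  · intro h
    simp only [h, cond_true]
    exact (hf a m).mono (by simp)
  · intro h
    simp only [h, cond_false]
    exact (hg a m).mono (by simp)
  · simp only [encSize, eval_add, eval_mul, eval_X, eval_C, eval_ofNat]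
    omega

@[fun_prop]
theorem ite {c : α → Prop} [DecidablePred c] {f g : α → β} (hc : PolyTime fun a => decide (c a))
    (hf : PolyTime f) (hg : PolyTime g) : PolyTime fun a => if c a then f a else g a := by
  simpa only [Bool.cond_decide] using cond hc hf hg

@[fun_prop]
theorem and {f g : α → Bool} (hf : PolyTime f) (hg : PolyTime g) :
    PolyTime fun a => f a && g a := by
  have : (fun a => f a && g a) = fun a => bif f a then g a else false := by
    funext a; cases f a <;> rfl
  rw [this]
  fun_prop

@[fun_prop]
theorem or {f g : α → Bool} (hf : PolyTime f) (hg : PolyTime g) :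
    PolyTime fun a => f a || g a := by
  have : (fun a => f a || g a) = fun a => bif f a then true else g a := by
    funext a; cases f a <;> rfl
  rw [this]
  fun_prop

@[fun_prop]
theorem not {f : α → Bool} (hf : PolyTime f) : PolyTime fun a => !f a := by
  have : (fun a => !f a) = fun a => bif f a then false else true := by
    funext a; cases f a <;> rfl
  rw [this]
  fun_prop

/-- Iterating a polynomial-time function while a polynomial-time test succeeds takes polynomial
time if the number of iterations and the lengths of the codes in between are bounded by a
polynomial. -/
theorem iterate {c : α → Bool} {g : α → α} {s : β → α} (hc : PolyTime c) (hg : PolyTime g)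
    (hs : PolyTime s) (n : β → ℕ)
    (q : Polynomial ℕ) (hn : ∀ b, n b ≤ q.eval (encSize b))
    (hlt : ∀ b i, i < n b → c (g^[i] (s b)) = true) (hend : ∀ b, c (g^[n b] (s b)) = false)
    (hq : ∀ b i, i ≤ n b → encSize (g^[i] (s b)) ≤ q.eval (encSize b)) :
    PolyTime fun b => g^[n b] (s b) := by
  obtain ⟨P, p, hc⟩ := hc
  obtain ⟨Pg, pg, hg⟩ := hg
  obtain ⟨Ps, ps, hs⟩ := hs
  let test := Prog.seq .dup P
  let r : Polynomial ℕ := 18 * q + p.comp q + pg.comp q + C 9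
  -- The code of `true` has three bits and that of `false` has one, which is what has to be removed.
  refine ⟨.seq Ps (.seq test (.seq (.loop .main (Prog.isTop true)
    (.seq (.pop .main) (.seq (.pop .main) (.seq (.pop .main) (.seq Pg test))))) (.pop .main))),
    ps + (2 * q + C 2) * (r + C 5), fun b m => ?_⟩
  have htest : ∀ i, i ≤ n b → Prog.RunLE test
      (Prog.mainOnly ((TreeEnc.enc (g^[i] (s b))).code ++ m))
      (Prog.mainOnly ((TreeEnc.enc (c (g^[i] (s b)))).code ++
        ((TreeEnc.enc (g^[i] (s b))).code ++ m)))
      (18 * q.eval (encSize b) + 5 + p.eval (q.eval (encSize b))) := fun i hi => by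
    refine ((Prog.run_dup _ m).seq (hc (g^[i] (s b)) _)).mono ?_
    have h₁ := hq b i hi
    have h₂ := eval_le (p := p) h₁
    simp only [encSize] at *
    omega
  have hloop : ∀ k i, i + k = n b → Prog.RunLE (.loop .main (Prog.isTop true)
      (.seq (.pop .main) (.seq (.pop .main) (.seq (.pop .main) (.seq Pg test)))))
      (Prog.mainOnly ((TreeEnc.enc (c (g^[i] (s b)))).code ++
        ((TreeEnc.enc (g^[i] (s b))).code ++ m)))
      (Prog.mainOnly ((TreeEnc.enc false).code ++ ((TreeEnc.enc (g^[n b] (s b))).code ++ m)))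
      (k * (r.eval (encSize b)) + 1) := by
    intro k
    induction k with
    | zero =>
      rintro i rfl
      rw [hend]
      exact (Prog.Run.loop_exit rfl).le (by omega)
    | succ k ih =>
      intro i hi
      rw [hlt b i (by omega)]
      refine (Prog.RunLE.loop_step rfl (((Prog.Run.pop .main _).le le_rfl).seq
        (((Prog.Run.pop .main _).le le_rfl).seq (((Prog.Run.pop .main _).le le_rfl).seq
        ((hg (g^[i] (s b)) m).seq ?_)))) (ih (i + 1) (by omega))).mono
        (T := 1 + (1 + (1 + (1 + (pg.eval (encSize (g^[i] (s b))) +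
          (18 * q.eval (encSize b) + 5 + p.eval (q.eval (encSize b))))))) +
          (k * (r.eval (encSize b)) + 1)) ?_
      · have h := htest (i + 1) (by omega)
        rw [Function.iterate_succ_apply'] at h ⊢
        exact h
      · have h₁ := eval_le (p := pg) (hq b i (by omega))
        have h₂ : r.eval (encSize b) = 18 * q.eval (encSize b) + p.eval (q.eval (encSize b)) +
          pg.eval (q.eval (encSize b)) + 9 := by simp [r]
        have h₃ := Nat.add_one_mul k (r.eval (encSize b))
        omega
  refine ((hs b m).seq ((htest 0 (by omega)).seq ((hloop (n b) 0 (by omega)).seq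
    ((Prog.Run.pop .main _).le le_rfl)))).mono ?_
  have h₁ := hn b
  have h₂ : r.eval (encSize b) = 18 * q.eval (encSize b) + p.eval (q.eval (encSize b)) +
    pg.eval (q.eval (encSize b)) + 9 := by simp [r]
  have h₃ := Nat.mul_le_mul_right (r.eval (encSize b)) h₁
  simp only [eval_mul, eval_add, eval_C, eval_ofNat]
  nlinarith [Nat.zero_le (q.eval (encSize b) * r.eval (encSize b))]

/-- The first bit of the code of a list tells whether the list is empty. -/
theorem list_casesOn' {f : α → β} {g : α × γ × List γ → β} (hf : PolyTime f) (hg : PolyTime g) :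
    PolyTime fun p : List γ × α =>
      (match p.1 with | [] => f p.2 | c :: l => g (p.2, c, l) : β) := by
  obtain ⟨P, p, hf⟩ := hf
  obtain ⟨P', p', hg⟩ := hg
  refine ⟨.seq (.pop .main) (.ite .main (Prog.isTop true) (.seq .swap (.seq (.push .main true) P'))
    (.seq (.pop .main) P)), 9 * X + p + p' + C 9, fun x m => ?_⟩
  rw [code_prod]
  obtain ⟨l, x⟩ := x
  cases l with
  | nil =>
    refine (((Prog.Run.pop .main _).le le_rfl).seq (Prog.RunLE.ite_false rfl
      (((Prog.Run.pop .main _).le le_rfl).seq (hf x m)))).mono ?_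
    have := eval_le (p := p) (show encSize x ≤ encSize (([] : List γ), x) by simp; omega)
    simp only [eval_mul, eval_add, eval_C, eval_ofNat, eval_X]
    omega
  | cons c l =>
    have hg' := hg (x, c, l) m
    rw [code_prod] at hg'
    refine (((Prog.Run.pop .main _).le le_rfl).seq (Prog.RunLE.ite_true rfl
      ((Prog.run_swap (TreeEnc.enc (c :: l)) (TreeEnc.enc x) m).seq
        (((Prog.Run.push .main true _).le le_rfl).seq hg')))).mono ?_
    have : encSize (x, c, l) = encSize (c :: l, x) := by simp; omega
    rw [this]
    have : (TreeEnc.enc (c :: l)).size + (TreeEnc.enc x).size + 1 = encSize (c :: l, x) := by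
      simp [encSize, TreeEnc.enc]
    simp only [eval_mul, eval_add, eval_C, eval_ofNat, eval_X]
    omega

@[fun_prop]
theorem list_casesOn {l : α → List γ} {f : α → β} {g : α → γ → List γ → β} (hl : PolyTime l)
    (hf : PolyTime f) (hg : PolyTime fun p : α × γ × List γ => g p.1 p.2.1 p.2.2) :
    PolyTime fun a => (match l a with | [] => f a | c :: t => g a c t : β) :=
  (list_casesOn' hf hg).comp (hl.prodMk id')

end PolyTime

/-! ### Polynomial-time operations on lists -/

/-- `List.zip` as a left fold: the state consists of the rest of the second list and the reversed
result. -/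
theorem List.zip_eq_foldl {α β : Type} (l : List α) (l' : List β) (r : List (α × β)) :
    (l.foldl (fun (s : List β × List (α × β)) a =>
      (match s.1 with
      | [] => ([], s.2)
      | b :: t => (t, (a, b) :: s.2) : List β × List (α × β))) (l', r)).2.reverse =
      r.reverse ++ l.zip l' := by
  induction l generalizing l' r with
  | nil => simp
  | cons a l ih => cases l' <;> simp [ih]

namespace PolyTime

open Polynomial

variable {α β γ σ ξ : Type} [TreeEnc α] [TreeEnc β] [TreeEnc γ] [TreeEnc σ] [TreeEnc ξ]

@[fun_prop]
theorem list_cons {f : ξ → α} {g : ξ → List α} (hf : PolyTime f) (hg : PolyTime g) :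
    PolyTime fun x => f x :: g x := by
  have h : PolyTime fun p : α × List α => p.1 :: p.2 := of_enc_eq fun _ => rfl
  exact h.comp (hf.prodMk hg)

/-- A left fold takes polynomial time if the lengths of the codes of all intermediate results are
bounded by a polynomial. -/
theorem foldl {l : ξ → List α} {i : ξ → σ} {f : ξ → σ → α → σ} (hl : PolyTime l) (hi : PolyTime i)
    (hf : PolyTime fun p : ξ × σ × α => f p.1 p.2.1 p.2.2) (q : Polynomial ℕ)
    (hq : ∀ x l', l' <+: l x → encSize (l'.foldl (f x) (i x)) ≤ q.eval (encSize x)) :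
    PolyTime fun x => (l x).foldl (f x) (i x) := by
  obtain ⟨Q, hQ⟩ := hl.exists_size_le
  let g : List α × σ × ξ → List α × σ × ξ := fun p =>
    match p.1 with
    | [] => p
    | a :: t => (t, f p.2.2 p.2.1 a, p.2.2)
  have hg : PolyTime g := by
    refine list_casesOn (by fun_prop) (by fun_prop) ?_
    exact PolyTime.prodMk (by fun_prop) (PolyTime.prodMk
      (hf.comp (f := fun p : (List α × σ × ξ) × α × List α => (p.1.2.2, p.1.2.1, p.2.1))
        (by fun_prop)) (by fun_prop))
  have hiter : ∀ x k,
      g^[k] (l x, i x, x) = ((l x).drop k, ((l x).take k).foldl (f x) (i x), x) := by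
    intro x k
    induction k with
    | zero => simp
    | succ k ih =>
      rw [Function.iterate_succ_apply', ih]
      by_cases hk : k < (l x).length
      · rw [List.drop_eq_getElem_cons hk, List.take_add_one, List.foldl_append]
        rw [List.getElem?_eq_getElem hk]
        rfl
      · have h₁ : (l x).drop k = [] := List.drop_eq_nil_of_le (by omega)
        have h₂ : (l x).drop (k + 1) = [] := List.drop_eq_nil_of_le (by omega)
        rw [h₁, h₂, List.take_of_length_le (show (l x).length ≤ k by omega),
          List.take_of_length_le (show (l x).length ≤ k + 1 by omega)]
  have hfold := iterate
    (c := fun p : List α × σ × ξ => match p.1 with | [] => false | _ :: _ => true)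
    (s := fun x => (l x, i x, x))
    (list_casesOn (by fun_prop) (by fun_prop) (by fun_prop)) hg (by fun_prop)
    (fun x => (l x).length)
    (q + Q + X + C 2) ?_ ?_ ?_ ?_
  · simp only [hiter, List.take_length] at hfold
    exact fst'.comp (snd'.comp hfold)
  · intro x
    have h₁ := length_le_encSize (l x)
    have h₂ := hQ x
    simp only [eval_add]
    omega
  · intro x k hk
    simp only [hiter, List.drop_eq_getElem_cons hk]
  · intro x
    simp only [hiter, List.drop_length]
  · intro x k hk
    have h₁ := encSize_le_of_sublist (List.drop_sublist k (l x))
    have h₂ := hQ x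
    have h₃ := hq x _ (List.take_prefix k (l x))
    simp only [hiter, encSize_prod, eval_add, eval_X, eval_C]
    omega

/-- A left fold takes polynomial time if each step lengthens the code of the intermediate result
by at most a polynomial in the lengths of the other arguments. -/
theorem foldl_of_growth {l : ξ → List α} {i : ξ → σ} {f : ξ → σ → α → σ} (hl : PolyTime l)
    (hi : PolyTime i) (hf : PolyTime fun p : ξ × σ × α => f p.1 p.2.1 p.2.2) (q : Polynomial ℕ)
    (hq : ∀ x s a, encSize (f x s a) ≤ encSize s + q.eval (encSize (x, a))) :
    PolyTime fun x => (l x).foldl (f x) (i x) := by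
  obtain ⟨Q, hQ⟩ := hl.exists_size_le
  obtain ⟨Q', hQ'⟩ := hi.exists_size_le
  refine foldl hl hi hf (Q' + Q * q.comp (X + Q + C 1)) fun x l' hl' => ?_
  have key : ∀ (l' : List α) (s : σ) (B : ℕ), (∀ a ∈ l', q.eval (encSize (x, a)) ≤ B) →
      encSize (l'.foldl (f x) s) ≤ encSize s + l'.length * B := by
    intro l'
    induction l' with
    | nil => simp
    | cons a l' ih =>
      intro s B hB
      have h₁ := ih (f x s a) B fun b hb => hB b (List.mem_cons_of_mem _ hb)
      have h₂ := hq x s a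
      have h₃ := hB a List.mem_cons_self
      rw [List.foldl_cons, List.length_cons, Nat.add_one_mul]
      omega
  refine (key l' (i x) (q.eval (encSize x + Q.eval (encSize x) + 1)) fun a ha => ?_).trans ?_
  · have h₁ := encSize_le_of_mem (hl'.subset ha)
    have h₂ := hQ x
    exact eval_le (by simp; omega)
  · simp only [eval_add, eval_mul, eval_comp, eval_X, eval_C]
    have h₁ := hl'.length_le.trans ((length_le_encSize (l x)).trans (hQ x))
    gcongr
    exact hQ' x

@[fun_prop]
theorem reverse {l : ξ → List α} (hl : PolyTime l) : PolyTime fun x => (l x).reverse := by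
  have h := foldl_of_growth (f := fun (_ : ξ) (s : List α) a => a :: s) hl (const []) (by fun_prop)
    X (fun x s a => by simp; omega)
  simpa using h

@[fun_prop]
theorem append {l l' : ξ → List α} (hl : PolyTime l) (hl' : PolyTime l') :
    PolyTime fun x => l x ++ l' x := by
  have h := foldl_of_growth (f := fun (_ : ξ) (s : List α) a => a :: s) hl.reverse hl' (by fun_prop)
    X (fun x s a => by simp; omega)
  simpa using h

theorem _root_.encSize_append (l l' : List α) : encSize (l ++ l') + 1 = encSize l + encSize l' := by
  induction l with
  | nil => simp; omega
  | cons a l ih => simp; omega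

@[fun_prop]
theorem flatMap {l : ξ → List α} {f : ξ → α → List β} (hl : PolyTime l)
    (hf : PolyTime fun p : ξ × α => f p.1 p.2) : PolyTime fun x => (l x).flatMap (f x) := by
  obtain ⟨Q, hQ⟩ := hf.exists_size_le
  have h := foldl_of_growth (f := fun (x : ξ) (s : List β) a => s ++ f x a) hl (const [])
    (append (by fun_prop) (hf.comp (f := fun p : ξ × List β × α => (p.1, p.2.2)) (by fun_prop)))
    Q (fun x s a => by
      have h₁ := hQ (x, a)
      have h₂ := encSize_append s (f x a)
      dsimp only at h₁
      omega)
  have e : ∀ (x : ξ) (l : List α) (s : List β),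
      l.foldl (fun s a => s ++ f x a) s = s ++ l.flatMap (f x) := by
    intro x l
    induction l with
    | nil => simp
    | cons a l ih => intro s; simp [ih]
  simpa [e] using h

@[fun_prop]
theorem map {l : ξ → List α} {f : ξ → α → β} (hl : PolyTime l)
    (hf : PolyTime fun p : ξ × α => f p.1 p.2) : PolyTime fun x => (l x).map (f x) := by
  have h := flatMap (f := fun x a => [f x a]) hl (by fun_prop)
  simpa only [← List.map_eq_flatMap] using h

@[fun_prop]
theorem filter {l : ξ → List α} {p : ξ → α → Bool} (hl : PolyTime l)
    (hp : PolyTime fun y : ξ × α => p y.1 y.2) : PolyTime fun x => (l x).filter (p x) := by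
  have h := flatMap (f := fun x a => bif p x a then [a] else []) hl (by fun_prop)
  have e : ∀ (x : ξ) (l : List α),
      l.flatMap (fun a => bif p x a then [a] else []) = l.filter (p x) := by
    intro x l
    induction l with
    | nil => rfl
    | cons a l ih => cases h : p x a <;> simp [ih, h]
  simpa only [e] using h

@[fun_prop]
theorem any {l : ξ → List α} {p : ξ → α → Bool} (hl : PolyTime l)
    (hp : PolyTime fun y : ξ × α => p y.1 y.2) : PolyTime fun x => (l x).any (p x) := by
  have h := foldl_of_growth (f := fun (x : ξ) (s : Bool) a => s || p x a) hl (const false)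
    (or (by fun_prop) (hp.comp (f := fun y : ξ × Bool × α => (y.1, y.2.2)) (by fun_prop)))
    (C 3) (fun x s a => by have := encSize_bool (s || p x a); simp; omega)
  have e : ∀ (x : ξ) (l : List α) (s : Bool),
      l.foldl (fun s a => s || p x a) s = (s || l.any (p x)) := by
    intro x l
    induction l with
    | nil => simp
    | cons a l ih => intro s; simp [ih, Bool.or_assoc]
  simpa [e] using h

@[fun_prop]
theorem all {l : ξ → List α} {p : ξ → α → Bool} (hl : PolyTime l)
    (hp : PolyTime fun y : ξ × α => p y.1 y.2) : PolyTime fun x => (l x).all (p x) := by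
  have h := not (any (p := fun x a => !p x a) hl (by fun_prop))
  simpa [List.all_eq_not_any_not] using h

/-- Membership in a list. -/
@[fun_prop]
theorem decide_mem {l : ξ → List α} {f : ξ → α} [DecidablePred fun x => f x ∈ l x]
    (hf : PolyTime f) (hl : PolyTime l) : PolyTime fun x => decide (f x ∈ l x) := by
  classical
  have h := any (p := fun x a => decide (f x = a)) hl (by fun_prop)
  have e : ∀ x, decide (f x ∈ l x) = (l x).any (fun a => decide (f x = a)) := fun x => by
    rw [Bool.eq_iff_iff]
    simp
  simpa only [e] using h

@[fun_prop]
theorem tail {l : ξ → List α} (hl : PolyTime l) : PolyTime fun x => (l x).tail := by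
  have h := list_casesOn (f := fun _ => []) (g := fun _ _ t => t) hl (by fun_prop) (by fun_prop)
  refine (congrArg PolyTime (funext fun x => ?_)).mp h
  cases l x <;> rfl

@[fun_prop]
theorem headD {l : ξ → List α} {d : ξ → α} (hl : PolyTime l) (hd : PolyTime d) :
    PolyTime fun x => (l x).headD (d x) := by
  have h := list_casesOn (f := d) (g := fun _ a _ => a) hl (by fun_prop) (by fun_prop)
  refine (congrArg PolyTime (funext fun x => ?_)).mp h
  cases l x <;> rfl

@[fun_prop]
theorem isEmpty {l : ξ → List α} (hl : PolyTime l) : PolyTime fun x => (l x).isEmpty := by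
  have h := list_casesOn (f := fun _ => true) (g := fun _ _ _ => false) hl (by fun_prop)
    (by fun_prop)
  refine (congrArg PolyTime (funext fun x => ?_)).mp h
  cases l x <;> rfl

@[fun_prop]
theorem zip {l : ξ → List α} {l' : ξ → List β} (hl : PolyTime l) (hl' : PolyTime l') :
    PolyTime fun x => (l x).zip (l' x) := by
  have h := foldl_of_growth (i := fun x => (l' x, ([] : List (α × β))))
    (f := fun (_ : ξ) (s : List β × List (α × β)) a =>
      (match s.1 with
      | [] => ([], s.2)
      | b :: t => (t, (a, b) :: s.2) : List β × List (α × β))) hl (by fun_prop)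
    (list_casesOn (by fun_prop) (by fun_prop) (by fun_prop)) (X + C 2) (fun x s a => by
      obtain ⟨s, r⟩ := s
      cases s <;> simp
      omega)
  have h' : PolyTime _ := reverse (snd'.comp h)
  simpa only [List.zip_eq_foldl, List.reverse_nil, List.nil_append] using h'

end PolyTime

/-! ### Binary arithmetic -/

namespace Bits

/-- The number with the given binary digits, least significant first. -/
def val : List Bool → ℕ
  | [] => 0
  | b :: l => b.toNat + 2 * val l

theorem val_append (l l' : List Bool) : val (l ++ l') = val l + 2 ^ l.length * val l' := by
  induction l with
  | nil => simp [val]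
  | cons b l ih => simp [val, ih, pow_succ]; ring

theorem val_map_false {α : Type} (l : List α) : val (l.map fun _ => false) = 0 := by
  induction l with
  | nil => rfl
  | cons a l ih => simp only [List.map_cons, val, ih]; rfl

theorem val_encodePosNum (p : PosNum) : val (Computability.encodePosNum p) = p := by
  induction p with
  | one => rfl
  | bit0 p ih => simp [Computability.encodePosNum, val, ih, PosNum.cast_bit0]; ring
  | bit1 p ih => simp [Computability.encodePosNum, val, ih, PosNum.cast_bit1]; ring

theorem val_encodeNat (n : ℕ) : val (Computability.encodeNat n) = n := by
  have h : ∀ m : Num, val (Computability.encodeNum m) = m := by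
    intro m
    cases m with
    | zero => rfl
    | pos p => exact val_encodePosNum p
  rw [Computability.encodeNat, h, Num.to_of_nat]

/-- Binary successor. -/
def succ : List Bool → List Bool
  | [] => [true]
  | false :: l => true :: l
  | true :: l => false :: succ l

theorem encodeNat_succ (n : ℕ) :
    Computability.encodeNat (n + 1) = succ (Computability.encodeNat n) := by
  have hp : ∀ p : PosNum, Computability.encodePosNum p.succ =
      succ (Computability.encodePosNum p) := by
    intro p
    induction p with
    | one => rfl
    | bit0 p ih => rfl
    | bit1 p ih => simp [PosNum.succ, Computability.encodePosNum, succ, ih]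
  have h : ∀ m : Num, Computability.encodeNum (m + 1) = succ (Computability.encodeNum m) := by
    intro m
    cases m with
    | zero => rfl
    | pos p =>
      have : Num.pos p + 1 = Num.pos p.succ := congrArg Num.pos (PosNum.add_one p)
      rw [this]
      exact hp p
  have := h (n : Num)
  rw [Computability.encodeNat, Nat.cast_succ, this]; rfl

/-- One step of the binary successor, as a left fold. The state consists of the carry and the
reversed result. -/
def succStep (s : Bool × List Bool) (b : Bool) : Bool × List Bool := (s.1 && b, (s.1 ^^ b) :: s.2)

theorem succ_eq_foldl (l : List Bool) : succ l =
    (l.foldl succStep (true, [])).2.reverse ++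
      bif (l.foldl succStep (true, [])).1 then [true] else [] := by
  have h₀ : ∀ (l r : List Bool),
      l.foldl succStep (false, r) = (false, l.reverse ++ r) := by
    intro l
    induction l with
    | nil => simp
    | cons b l ih => intro r; simp [ih, succStep]
  have h₁ : ∀ (l r : List Bool), r.reverse ++ succ l =
      (l.foldl succStep (true, r)).2.reverse ++
        bif (l.foldl succStep (true, r)).1 then [true] else [] := by
    intro l
    induction l with
    | nil => simp [succ]
    | cons b l ih =>
      intro r
      cases b
      · simp [succ, succStep, h₀]
      · have := ih (false :: r)
        simpa [succ, succStep] using this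
  simpa using h₁ l []

/-- The digits of two numbers in parallel, the shorter list being filled up with zeros. -/
def pad (a b : List Bool) : List (Bool × Bool) :=
  (a ++ b.map fun _ => false).zip (b ++ a.map fun _ => false)

theorem val_pad_fst (a b : List Bool) : val ((pad a b).map Prod.fst) = val a := by
  rw [pad, List.map_fst_zip (by simp; omega), val_append, val_map_false]
  simp

theorem val_pad_snd (a b : List Bool) : val ((pad a b).map Prod.snd) = val b := by
  rw [pad, List.map_snd_zip (by simp; omega), val_append, val_map_false]
  simp

theorem length_pad (a b : List Bool) : (pad a b).length = a.length + b.length := by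
  simp [pad]; omega

/-- Addition with carry, digit by digit. The state consists of the carry and the reversed
result. -/
def addStep (s : Bool × List Bool) (p : Bool × Bool) : Bool × List Bool :=
  ((p.1 && p.2) || (s.1 && (p.1 ^^ p.2)), ((p.1 ^^ p.2) ^^ s.1) :: s.2)

/-- Binary addition. -/
def add (a b : List Bool) : List Bool :=
  ((pad a b).foldl addStep (false, [])).2.reverse ++ [((pad a b).foldl addStep (false, [])).1]

theorem foldl_addStep (z : List (Bool × Bool)) (c : Bool) (r : List Bool) :
    val ((z.foldl addStep (c, r)).2.reverse ++ [(z.foldl addStep (c, r)).1]) =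
      val r.reverse + 2 ^ r.length * (c.toNat + val (z.map Prod.fst) + val (z.map Prod.snd)) := by
  induction z generalizing c r with
  | nil => simp [val_append, val]
  | cons p z ih =>
    obtain ⟨x, y⟩ := p
    rw [List.foldl_cons, addStep, ih]
    cases x <;> cases y <;> cases c <;> simp [val_append, val, pow_succ] <;> ring

theorem val_add (a b : List Bool) : val (add a b) = val a + val b := by
  rw [add, foldl_addStep, val_pad_fst, val_pad_snd]
  simp [val]

theorem length_foldl_addStep (z : List (Bool × Bool)) (s : Bool × List Bool) :
    (z.foldl addStep s).2.length = z.length + s.2.length := by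
  induction z generalizing s with
  | nil => simp
  | cons p z ih => rw [List.foldl_cons, ih, addStep]; simp; omega

theorem length_add (a b : List Bool) : (add a b).length = a.length + b.length + 1 := by
  simp [add, length_foldl_addStep, length_pad]

/-- One step of the multiplication by `b`, for the next digit `x` of the other factor. -/
def mulStep (b acc : List Bool) (x : Bool) : List Bool :=
  bif x then add (false :: acc) b else false :: acc

/-- Binary multiplication. -/
def mul (a b : List Bool) : List Bool := a.reverse.foldl (mulStep b) []

theorem val_mul (a b : List Bool) : val (mul a b) = val a * val b := by
  rw [mul, List.foldl_reverse]
  induction a with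
  | nil => simp [val]
  | cons x a ih =>
    rw [List.foldr_cons]
    generalize a.foldr _ [] = r at ih ⊢
    cases x <;> simp [mulStep, val, val_add, ih] <;> ring

theorem length_foldl_mulStep (b l acc : List Bool) :
    (l.foldl (mulStep b) acc).length ≤ acc.length + l.length * (b.length + 2) := by
  induction l generalizing acc with
  | nil => simp
  | cons x l ih =>
    have h := ih (mulStep b acc x)
    have h' : (mulStep b acc x).length ≤ acc.length + (b.length + 2) := by
      cases x <;> simp [mulStep, length_add]
      omega
    rw [List.foldl_cons, List.length_cons, Nat.add_one_mul]
    omega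

/-- Comparison of binary numbers: the most significant digit at which they differ decides. -/
def le (a b : List Bool) : Bool :=
  (pad a b).foldl (fun r p => bif p.1 ^^ p.2 then p.2 else r) true

theorem le_eq (a b : List Bool) : le a b = decide (val a ≤ val b) := by
  have h : ∀ (z : List (Bool × Bool)) (r : Bool),
      (z.foldl (fun r p => bif p.1 ^^ p.2 then p.2 else r) r = true ↔
        val (z.map Prod.fst) < val (z.map Prod.snd) ∨
          val (z.map Prod.fst) = val (z.map Prod.snd) ∧ r = true) := by
    intro z
    induction z with
    | nil => simp [val]
    | cons p z ih =>
      intro r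
      obtain ⟨x, y⟩ := p
      rw [List.foldl_cons, ih]
      cases x <;> cases y <;> simp [val] <;> omega
  rw [Bool.eq_iff_iff, le, h, val_pad_fst, val_pad_snd, decide_eq_true_iff]
  simp only [and_true]
  omega

end Bits

theorem encSize_bits_le (l : List Bool) : encSize l ≤ 4 * l.length + 1 := by
  induction l with
  | nil => simp
  | cons b l ih => have := encSize_bool b; simp; omega

instance : TreeEnc ℕ := ⟨fun n => TreeEnc.enc (Computability.encodeNat n), fun m n h => by
  rw [← Bits.val_encodeNat m, ← Bits.val_encodeNat n, TreeEnc.enc_injective h]⟩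

/-- Sign, absolute value of the numerator, and denominator, in binary. -/
def ratParts (q : ℚ) : Bool × List Bool × List Bool :=
  (decide (q < 0), Computability.encodeNat q.num.natAbs, Computability.encodeNat q.den)

theorem ratParts_injective : Function.Injective ratParts := by
  intro p q h
  simp only [ratParts, Prod.mk.injEq, decide_eq_decide] at h
  obtain ⟨h₁, h₂, h₃⟩ := h
  have h₂ := congrArg Bits.val h₂
  have h₃ := congrArg Bits.val h₃
  rw [Bits.val_encodeNat, Bits.val_encodeNat] at h₂ h₃
  rw [← Rat.num_neg, ← Rat.num_neg] at h₁
  exact Rat.ext (by omega) h₃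

instance : TreeEnc ℚ := ⟨fun q => TreeEnc.enc (ratParts q), fun _ _ h =>
  ratParts_injective (TreeEnc.enc_injective h)⟩

/-- Comparison of fractions that are given by sign, absolute value of the numerator, and
denominator. -/
def ratPartsLe (a b : Bool × List Bool × List Bool) : Bool :=
  bif a.1 then
    bif b.1 then Bits.le (Bits.mul b.2.1 a.2.2) (Bits.mul a.2.1 b.2.2) else true
  else
    bif b.1 then false else Bits.le (Bits.mul a.2.1 b.2.2) (Bits.mul b.2.1 a.2.2)

theorem ratPartsLe_ratParts (p q : ℚ) :
    ratPartsLe (ratParts p) (ratParts q) = decide (p ≤ q) := by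
  simp only [ratPartsLe, ratParts, Bits.le_eq, Bits.val_mul, Bits.val_encodeNat, ← Rat.num_neg]
  rw [Bool.eq_iff_iff, decide_eq_true_iff (p := p ≤ q), Rat.le_iff]
  have hp : (0 : ℤ) < p.den := by exact_mod_cast p.den_pos
  have hq : (0 : ℤ) < q.den := by exact_mod_cast q.den_pos
  by_cases h₁ : p.num < 0 <;> by_cases h₂ : q.num < 0 <;>
    simp only [h₁, h₂, decide_true, decide_false, cond_true, cond_false, decide_eq_true_iff]
  · zify
    rw [abs_of_neg h₁, abs_of_neg h₂]
    constructor <;> intro h <;> linarith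
  · simp only [true_iff]
    nlinarith
  · simp only [Bool.false_eq_true, false_iff, not_le]
    nlinarith
  · zify
    rw [abs_of_nonneg (not_lt.1 h₁), abs_of_nonneg (not_lt.1 h₂)]

namespace PolyTime

open Polynomial

variable {α β γ σ ξ : Type} [TreeEnc α] [TreeEnc β] [TreeEnc γ] [TreeEnc σ] [TreeEnc ξ]

@[fun_prop]
theorem xor {f g : α → Bool} (hf : PolyTime f) (hg : PolyTime g) :
    PolyTime fun a => f a ^^ g a := by
  have : (fun a => f a ^^ g a) = fun a => bif f a then !g a else g a := by
    funext a; cases f a <;> simp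
  rw [this]
  fun_prop

@[fun_prop]
theorem bits_add {f g : ξ → List Bool} (hf : PolyTime f) (hg : PolyTime g) :
    PolyTime fun x => Bits.add (f x) (g x) := by
  have hp : PolyTime fun x => Bits.pad (f x) (g x) := by unfold Bits.pad; fun_prop
  have h := foldl_of_growth (i := fun _ => (false, [])) (f := fun _ => Bits.addStep) hp (const _)
    (by unfold Bits.addStep; fun_prop) (C 7) (fun x s a => by
      have h₁ := encSize_bool (Bits.addStep s a).1
      have h₂ := encSize_bool ((a.1 ^^ a.2) ^^ s.1)
      simp [Bits.addStep] at *
      omega)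
  unfold Bits.add
  fun_prop

@[fun_prop]
theorem bits_le {f g : ξ → List Bool} (hf : PolyTime f) (hg : PolyTime g) :
    PolyTime fun x => Bits.le (f x) (g x) := by
  have hp : PolyTime fun x => Bits.pad (f x) (g x) := by unfold Bits.pad; fun_prop
  exact foldl_of_growth (i := fun _ => true) (f := fun _ r p => bif p.1 ^^ p.2 then p.2 else r)
    hp (const _) (by fun_prop) (C 3) (fun x s a => by
      have := encSize_bool (bif a.1 ^^ a.2 then a.2 else s)
      simp only [eval_C]
      omega)

@[fun_prop]
theorem bits_mul {f g : ξ → List Bool} (hf : PolyTime f) (hg : PolyTime g) :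
    PolyTime fun x => Bits.mul (f x) (g x) := by
  obtain ⟨Q, hQ⟩ := hf.exists_size_le
  obtain ⟨Q', hQ'⟩ := hg.exists_size_le
  refine foldl (i := fun _ => []) (f := fun x => Bits.mulStep (g x)) hf.reverse (const _)
    (by unfold Bits.mulStep; fun_prop) (4 * (Q * (Q' + C 2)) + C 1) fun x l' hl' => ?_
  have h₁ := encSize_bits_le (l'.foldl (Bits.mulStep (g x)) [])
  have h₂ := Bits.length_foldl_mulStep (g x) l' []
  have h₃ := hl'.length_le
  have h₄ := (length_le_encSize (f x)).trans (hQ x)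
  have h₅ := (length_le_encSize (g x)).trans (hQ' x)
  rw [List.length_reverse] at h₃
  have h₆ := Nat.mul_le_mul (h₃.trans h₄) (Nat.add_le_add_right h₅ 2)
  simp only [eval_add, eval_mul, eval_C, eval_ofNat, List.length_nil] at *
  omega

@[fun_prop]
theorem nat_succ {f : ξ → ℕ} (hf : PolyTime f) : PolyTime fun x => f x + 1 := by
  have h₀ : PolyTime Computability.encodeNat := of_enc_eq fun _ => rfl
  have h₁ := foldl_of_growth (i := fun _ => (true, ([] : List Bool)))
    (f := fun _ => Bits.succStep) (h₀.comp hf) (const _)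
    (by unfold Bits.succStep; fun_prop) (C 7) (fun x s a => by
      have h₁ := encSize_bool (s.1 && a)
      have h₂ := encSize_bool (s.1 ^^ a)
      simp [Bits.succStep] at *
      omega)
  have h₂ : PolyTime fun x => Bits.succ (Computability.encodeNat (f x)) := by
    simp only [Bits.succ_eq_foldl]
    fun_prop
  obtain ⟨P, p, h⟩ := h₂
  refine ⟨P, p, fun a m => ?_⟩
  have := h a m
  simp only [← Bits.encodeNat_succ] at this
  exact this

@[fun_prop]
theorem nat_le {f g : ξ → ℕ} (hf : PolyTime f) (hg : PolyTime g) :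
    PolyTime fun x => decide (f x ≤ g x) := by
  have h₀ : PolyTime Computability.encodeNat := of_enc_eq fun _ => rfl
  have h := bits_le (h₀.comp hf) (h₀.comp hg)
  simpa only [Bits.le_eq, Bits.val_encodeNat] using h

@[fun_prop]
theorem rat_le {f g : ξ → ℚ} (hf : PolyTime f) (hg : PolyTime g) :
    PolyTime fun x => decide (f x ≤ g x) := by
  have h₀ : PolyTime ratParts := of_enc_eq fun _ => rfl
  have h₁ : PolyTime fun p : (Bool × List Bool × List Bool) × Bool × List Bool × List Bool =>
      ratPartsLe p.1 p.2 := by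
    unfold ratPartsLe
    fun_prop
  simpa only [ratPartsLe_ratParts] using h₁.comp ((h₀.comp hf).prodMk (h₀.comp hg))

end PolyTime

/-! ### Two-satisfiability -/

/-- Transitive closure of a relation `r` through the intermediate points in a list, by the
Floyd–Warshall recursion. -/
def warshall {L : Type} (r : L → L → Prop) : List L → L → L → Prop
  | [], x, y => r x y
  | k :: ks, x, y => warshall r ks x y ∨ warshall r ks x k ∧ warshall r ks k y

section Warshall

variable {L : Type} {r : L → L → Prop}

theorem warshall_of_rel (ks : List L) {x y : L} (h : r x y) : warshall r ks x y := by
  induction ks with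
  | nil => exact h
  | cons k ks ih => exact .inl ih

theorem warshall_trans {ks : List L} {k x y : L} (hk : k ∈ ks) (h₁ : warshall r ks x k)
    (h₂ : warshall r ks k y) : warshall r ks x y := by
  induction ks generalizing x y k with
  | nil => simp at hk
  | cons a ks ih =>
    rcases List.mem_cons.1 hk with rfl | hk
    · exact .inr ⟨h₁.elim id And.left, h₂.elim id And.right⟩
    · rcases h₁ with h₁ | ⟨h₁, h₁'⟩ <;> rcases h₂ with h₂ | ⟨h₂, h₂'⟩
      · exact .inl (ih hk h₁ h₂)
      · exact .inr ⟨ih hk h₁ h₂, h₂'⟩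
      · exact .inr ⟨h₁, ih hk h₁' h₂⟩
      · exact .inr ⟨h₁, h₂'⟩

theorem transGen_of_warshall {ks : List L} {x y : L} (h : warshall r ks x y) :
    Relation.TransGen r x y := by
  induction ks generalizing x y with
  | nil => exact .single h
  | cons k ks ih => exact h.elim ih fun h => (ih h.1).trans (ih h.2)

/-- If the list contains the first members of all pairs, the recursion yields the transitive
closure. -/
theorem warshall_iff_transGen {ks : List L} (hks : ∀ x y, r x y → x ∈ ks) {x y : L} :
    warshall r ks x y ↔ Relation.TransGen r x y := by
  refine ⟨transGen_of_warshall, fun h => ?_⟩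
  induction h with
  | single h => exact warshall_of_rel ks h
  | tail _ h ih => exact warshall_trans (hks _ _ h) ih (warshall_of_rel ks h)

end Warshall

/-- A choice of one of two options for each element of a set such that no two chosen options are in
conflict exists unless the implications between the options that the conflicts give contain a cycle
through both options of an element. -/
theorem exists_choice_iff {E : Type} (S : Finset E) (C : E × Bool → E × Bool → Prop)
    (hC : ∀ x y, C x y → C y x) :
    (∃ c : E → Bool, ∀ e ∈ S, ∀ f ∈ S, ¬ C (e, c e) (f, c f)) ↔
      ∀ e ∈ S, ∀ b : Bool, ¬ (
        Relation.TransGen (fun x y : E × Bool => x.1 ∈ S ∧ y.1 ∈ S ∧ C x (y.1, !y.2))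
          (e, b) (e, !b) ∧
        Relation.TransGen (fun x y : E × Bool => x.1 ∈ S ∧ y.1 ∈ S ∧ C x (y.1, !y.2))
          (e, !b) (e, b)) := by
  classical
  set r : E × Bool → E × Bool → Prop := fun x y => x.1 ∈ S ∧ y.1 ∈ S ∧ C x (y.1, !y.2) with hr
  let neg : E × Bool → E × Bool := fun x => (x.1, !x.2)
  have hneg : ∀ x, neg (neg x) = x := fun x => by simp [neg]
  have hskew : ∀ x y, Relation.TransGen r x y → Relation.TransGen r (neg y) (neg x) := by
    intro x y h
    induction h with
    | single h =>
      refine .single ⟨h.2.1, h.1, ?_⟩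
      have := hC _ _ h.2.2
      simpa [neg] using this
    | tail _ h ih =>
      refine .head (b := neg _) ⟨h.2.1, h.1, ?_⟩ ih
      have := hC _ _ h.2.2
      simpa [neg] using this
  constructor
  · rintro ⟨c, hc⟩ e he b ⟨h₁, h₂⟩
    have hclosed : ∀ x y, Relation.TransGen r x y → x.2 = c x.1 → y.2 = c y.1 := by
      intro x y h hx
      have step : ∀ x y, r x y → x.2 = c x.1 → y.2 = c y.1 := by
        rintro ⟨x, a⟩ ⟨y, b⟩ ⟨h₁, h₂, h₃⟩ (rfl : a = c x)
        change b = c y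
        by_contra hne
        have : c y = !b := by cases h : c y <;> cases b <;> simp_all
        exact hc x h₁ y h₂ (by rw [this]; exact h₃)
      induction h with
      | single h => exact step _ _ h hx
      | tail _ h ih => exact step _ _ h ih
    by_cases hb : b = c e
    · have := hclosed _ _ h₁ hb
      simp [← hb] at this
    · have hb' : (!b) = c e := by cases h : c e <;> cases b <;> simp_all
      exact hb (hclosed _ _ h₂ hb')
  · intro H
    -- A maximal consistent set of literals that is closed under implication.
    let P : Finset (E × Bool) → Prop := fun A => A ⊆ S ×ˢ Finset.univ ∧
      (∀ x ∈ A, ∀ y, Relation.TransGen r x y → y ∈ A) ∧ ∀ x ∈ A, neg x ∉ A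
    obtain ⟨A, hA, hmax⟩ : ∃ A, P A ∧ ∀ B, P B → A ⊆ B → B ⊆ A := by
      have hfin : {A | P A}.Finite := ((S ×ˢ Finset.univ).powerset.finite_toSet).subset
        fun A hA => Finset.mem_coe.2 (Finset.mem_powerset.2 hA.1)
      obtain ⟨A, hA⟩ := hfin.exists_maximal ⟨∅, by simp [P]⟩
      exact ⟨A, hA.1, fun B hB h => hA.2 hB h⟩
    obtain ⟨hsub, hcl, hcons⟩ := hA
    have hmem : ∀ x y, Relation.TransGen r x y → y.1 ∈ S := by
      intro x y h
      induction h with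
      | single h => exact h.2.1
      | tail _ h _ => exact h.2.1
    have htotal : ∀ e ∈ S, ∀ b, (e, b) ∈ A ∨ (e, !b) ∈ A := by
      by_contra! hcon
      obtain ⟨e, he, b₀, hb₁, hb₂⟩ := hcon
      obtain ⟨b, hb, hnb, hx⟩ : ∃ b, (e, b) ∉ A ∧ (e, !b) ∉ A ∧
          ¬ Relation.TransGen r (e, b) (e, !b) := by
        by_cases h : Relation.TransGen r (e, b₀) (e, !b₀)
        · exact ⟨!b₀, hb₂, by simpa using hb₁, fun h' => H e he b₀ ⟨h, by simpa using h'⟩⟩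
        · exact ⟨b₀, hb₁, hb₂, h⟩
      let B : Finset (E × Bool) := (S ×ˢ Finset.univ).filter fun y =>
        y ∈ A ∨ y = (e, b) ∨ Relation.TransGen r (e, b) y
      have hmemB : ∀ y, y ∈ B ↔ y ∈ A ∨ y = (e, b) ∨ Relation.TransGen r (e, b) y := by
        intro y
        simp only [B, Finset.mem_filter, Finset.mem_product, Finset.mem_univ, and_true,
          and_iff_right_iff_imp]
        rintro (h | rfl | h)
        · exact (Finset.mem_product.1 (hsub h)).1
        · exact he
        · exact hmem _ _ h
      refine hb (hmax B ⟨Finset.filter_subset _ _, ?_, ?_⟩ (fun y hy => (hmemB y).2 (.inl hy))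
        ((hmemB _).2 (.inr (.inl rfl))))
      · intro x hx y hxy
        rw [hmemB] at hx ⊢
        rcases hx with hx | rfl | hx
        · exact .inl (hcl x hx y hxy)
        · exact .inr (.inr hxy)
        · exact .inr (.inr (hx.trans hxy))
      · have key : ∀ y, neg y ∈ A → ¬ (y = (e, b) ∨ Relation.TransGen r (e, b) y) := by
          rintro y hy (rfl | h)
          · exact hnb hy
          · exact hnb (hcl _ hy _ (hskew _ _ h))
        intro y hy hny
        rw [hmemB] at hy hny
        rcases hy with hy | hy
        · rcases hny with hny | hny
          · exact hcons y hy hny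
          · exact key (neg y) (by rwa [hneg]) hny
        · rcases hny with hny | hny
          · exact key y hny hy
          · rcases hy with rfl | hy
            · rcases hny with h | h
              · simp [neg] at h
              · exact hx h
            · rcases hny with h | h
              · have : y = (e, !b) := by rw [← hneg y, h]
                exact hx (this ▸ hy)
              · have h' := hskew _ _ h
                rw [hneg] at h'
                exact hx (hy.trans h')
    refine ⟨fun e => decide ((e, true) ∈ A), fun e he f hf hconf => ?_⟩
    have hch : ∀ e ∈ S, (e, decide ((e, true) ∈ A)) ∈ A := by
      intro e he
      by_cases h : (e, true) ∈ A
      · simp [h]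
      · simpa [h] using htotal e he true
    have h₁ := hcl _ (hch e he) (neg (f, decide ((f, true) ∈ A)))
      (.single ⟨he, hf, by simpa [neg] using hconf⟩)
    exact hcons _ (hch f hf) h₁

/-! ### Deciding two-satisfiability in polynomial time -/

section Closure

variable {L : Type} [DecidableEq L]

/-- One round of the Floyd–Warshall algorithm, with the intermediate point `k`, for a relation on
the list `l` that is given by the list `R` of its pairs. -/
def warshallStep (l : List L) (R : List (L × L)) (k : L) : List (L × L) :=
  (l.flatMap fun x => l.map fun y => (x, y)).filter fun p =>
    decide (p ∈ R) || (decide ((p.1, k) ∈ R) && decide ((k, p.2) ∈ R))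

/-- The pairs of the transitive closure of the relation `r` on the list `l`. -/
def closureList (l : List L) (r : L → L → Bool) : List (L × L) :=
  l.foldl (warshallStep l) ((l.flatMap fun x => l.map fun y => (x, y)).filter fun p => r p.1 p.2)

theorem mem_closureList (l : List L) (r : L → L → Bool) (x y : L) :
    (x, y) ∈ closureList l r ↔
      Relation.TransGen (fun x y => x ∈ l ∧ y ∈ l ∧ r x y = true) x y := by
  have hpair : ∀ x y : L, (x, y) ∈ (l.flatMap fun x => l.map fun y => (x, y)) ↔ x ∈ l ∧ y ∈ l := by
    simp
  have key : ∀ ks : List L, (∀ k ∈ ks, k ∈ l) → ∀ x y,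
      (x, y) ∈ ks.reverse.foldl (warshallStep l)
        ((l.flatMap fun x => l.map fun y => (x, y)).filter fun p => r p.1 p.2) ↔
      warshall (fun x y => x ∈ l ∧ y ∈ l ∧ r x y = true) ks x y := by
    intro ks
    induction ks with
    | nil => intro _ x y; simp [warshall, and_assoc]
    | cons k ks ih =>
      intro hk x y
      have ih := ih fun k' h => hk k' (List.mem_cons_of_mem _ h)
      have hm : ∀ x y, warshall (fun x y => x ∈ l ∧ y ∈ l ∧ r x y = true) ks x y →
          x ∈ l ∧ y ∈ l := by
        intro x y h
        have h := transGen_of_warshall h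
        exact ⟨(Relation.TransGen.head'_iff.1 h).choose_spec.1.1,
          (Relation.TransGen.tail'_iff.1 h).choose_spec.2.2.1⟩
      rw [List.reverse_cons, List.foldl_append, List.foldl_cons, List.foldl_nil, warshallStep,
        List.mem_filter, hpair]
      simp only [Bool.or_eq_true, Bool.and_eq_true, decide_eq_true_iff, ih, warshall]
      constructor
      · exact And.right
      · rintro (h | h)
        · exact ⟨hm _ _ h, .inl h⟩
        · exact ⟨⟨(hm _ _ h.1).1, (hm _ _ h.2).2⟩, .inr h⟩
  have h := key l.reverse (fun k hk => List.mem_reverse.1 hk) x y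
  rw [List.reverse_reverse] at h
  rw [closureList, h, warshall_iff_transGen]
  intro x y h
  exact List.mem_reverse.2 h.1

end Closure

/-- The two literals of each element of a list. -/
def literals {E : Type} (l : List E) : List (E × Bool) := l.flatMap fun e => [(e, true), (e, false)]

/-- The implications between literals that the conflicts `C` give are closed transitively, and no
literal and its negation may imply each other. -/
def satisfiable {E : Type} [DecidableEq E] (l : List E) (C : E × Bool → E × Bool → Bool) : Bool :=
  (literals l).all fun x =>
    !(decide ((x, (x.1, !x.2)) ∈ closureList (literals l) fun x y => C x (y.1, !y.2)) &&
      decide (((x.1, !x.2), x) ∈ closureList (literals l) fun x y => C x (y.1, !y.2)))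

theorem satisfiable_iff {E : Type} [DecidableEq E] (l : List E) (C : E × Bool → E × Bool → Bool)
    (hC : ∀ x y, C x y = C y x) : satisfiable l C = true ↔
      ∃ c : E → Bool, ∀ e ∈ l, ∀ f ∈ l, C (e, c e) (f, c f) = false := by
  have h := exists_choice_iff l.toFinset (fun x y => C x y = true) fun x y h => by rwa [hC]
  have hmem : ∀ x, x ∈ literals l ↔ x.1 ∈ l := by
    rintro ⟨e, b⟩
    cases b <;> simp [literals]
  simp only [List.mem_toFinset, Bool.not_eq_true] at h
  rw [h, satisfiable, List.all_eq_true]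
  simp only [Bool.not_eq_true', Bool.and_eq_false_iff, decide_eq_false_iff_not, mem_closureList,
    hmem, not_and_or, Prod.forall]
  exact forall_congr' fun e => ⟨fun H he b => H b he, fun H b he => H he b⟩

namespace PolyTime

open Polynomial

variable {α β γ σ ξ : Type} [TreeEnc α] [TreeEnc β] [TreeEnc γ] [TreeEnc σ] [TreeEnc ξ]

theorem closureList [DecidableEq α] {l : ξ → List α} {r : ξ → α → α → Bool} (hl : PolyTime l)
    (hr : PolyTime fun p : ξ × α × α => r p.1 p.2.1 p.2.2) :
    PolyTime fun x => closureList (l x) (r x) := by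
  have hp : PolyTime fun x => (l x).flatMap fun a => (l x).map fun b => (a, b) := by fun_prop
  have hi : PolyTime fun x =>
      ((l x).flatMap fun a => (l x).map fun b => (a, b)).filter fun p => r x p.1 p.2 :=
    filter hp (hr.comp (f := fun y : ξ × α × α => (y.1, y.2.1, y.2.2)) (by fun_prop))
  obtain ⟨Q, hQ⟩ := hp.exists_size_le
  refine foldl (f := fun x => warshallStep (l x)) hl hi (by unfold warshallStep; fun_prop) Q
    fun x l' _ => ?_
  -- Every intermediate result is a sublist of the list of all pairs.
  refine le_trans (encSize_le_of_sublist ?_) (hQ x)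
  induction l' using List.reverseRecOn with
  | nil => exact List.filter_sublist
  | append_singleton l' a _ =>
    rw [List.foldl_append]
    exact List.filter_sublist

theorem satisfiable [DecidableEq α] {l : ξ → List α} {C : ξ → α × Bool → α × Bool → Bool}
    (hl : PolyTime l) (hC : PolyTime fun p : ξ × (α × Bool) × α × Bool => C p.1 p.2.1 p.2.2) :
    PolyTime fun x => satisfiable (l x) (C x) := by
  have h₁ : PolyTime fun x => literals (l x) := by unfold literals; fun_prop
  have h₂ : PolyTime fun x => _root_.closureList (literals (l x)) fun y z => C x y (z.1, !z.2) :=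
    closureList h₁ (hC.comp (f := fun p : ξ × (α × Bool) × α × Bool =>
      (p.1, p.2.1, (p.2.2.1, !p.2.2.2))) (by fun_prop))
  unfold _root_.satisfiable
  exact all h₁ (not (and (decide_mem (by fun_prop) (h₂.comp fst'))
    (decide_mem (by fun_prop) (h₂.comp fst'))))

theorem _root_.List.zipIdx_eq_foldl {α : Type} (l : List α) (n : ℕ) (r : List (α × ℕ)) :
    l.foldl (fun (s : ℕ × List (α × ℕ)) a => (s.1 + 1, (a, s.1) :: s.2)) (n, r) =
      (n + l.length, (l.zipIdx n).reverse ++ r) := by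
  induction l generalizing n r with
  | nil => simp
  | cons a l ih => simp [ih, List.zipIdx_cons]; omega

theorem encSize_succ_le (n : ℕ) : encSize (n + 1) ≤ encSize n + 4 := by
  have h : ∀ l : List Bool, encSize (Bits.succ l) ≤ encSize l + 4 := by
    intro l
    have ht : encSize true = 3 := rfl
    have hf : encSize false = 1 := rfl
    induction l with
    | nil => simp [Bits.succ, ht]
    | cons b l ih =>
      cases b
      · simp [Bits.succ, ht, hf]; omega
      · simp [Bits.succ, ht, hf]; omega
  have := h (Computability.encodeNat n)
  rwa [← Bits.encodeNat_succ] at this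

theorem encSize_nat_le (n : ℕ) : encSize n ≤ 4 * n + 1 := by
  induction n with
  | zero => exact le_of_eq rfl
  | succ n ih => have := encSize_succ_le n; omega

theorem encSize_zipIdx_le (l : List α) (n : ℕ) :
    encSize (l.zipIdx n) ≤ encSize l + l.length * (4 * (n + l.length) + 2) := by
  induction l generalizing n with
  | nil => simp
  | cons a l ih =>
    have h₁ := ih (n + 1)
    have h₂ := encSize_nat_le n
    simp only [List.zipIdx_cons, encSize_cons, encSize_prod, List.length_cons]
    have h₃ : (l.length + 1) * (4 * (n + (l.length + 1)) + 2) =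
      l.length * (4 * (n + 1 + l.length) + 2) + (4 * (n + (l.length + 1)) + 2) := by ring
    omega

theorem encSize_reverse (l : List α) : encSize l.reverse = encSize l := by
  induction l with
  | nil => rfl
  | cons a l ih =>
    have := encSize_append l.reverse [a]
    simp at *
    omega

@[fun_prop]
theorem zipIdx {l : ξ → List α} (hl : PolyTime l) : PolyTime fun x => (l x).zipIdx := by
  obtain ⟨Q, hQ⟩ := hl.exists_size_le
  have h := foldl (i := fun _ => (0, ([] : List (α × ℕ))))
    (f := fun _ (s : ℕ × List (α × ℕ)) a => (s.1 + 1, (a, s.1) :: s.2)) hl (const _)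
    (by fun_prop) (4 * Q + 2 + (Q + Q * (4 * Q + 2))) (fun x l' hl' => by
      have h₁ := hl'.length_le.trans ((length_le_encSize _).trans (hQ x))
      have h₂ := (encSize_le_of_sublist hl'.sublist).trans (hQ x)
      have h₃ := encSize_zipIdx_le l' 0
      have h₄ := encSize_nat_le (0 + l'.length)
      have h₅ : l'.length * (4 * (0 + l'.length) + 2) ≤
        Q.eval (encSize x) * (4 * Q.eval (encSize x) + 2) := by gcongr; omega
      rw [List.zipIdx_eq_foldl, List.append_nil, encSize_prod, encSize_reverse]
      simp only [eval_add, eval_mul, eval_ofNat]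
      omega)
  have h' := (snd'.comp h).reverse
  simpa [List.zipIdx_eq_foldl] using h'

@[fun_prop]
theorem drop (k : ℕ) {l : ξ → List α} (hl : PolyTime l) : PolyTime fun x => (l x).drop k := by
  induction k with
  | zero => simpa using hl
  | succ k ih => simpa using ih.tail

@[fun_prop]
theorem length_le (k : ℕ) {l : ξ → List α} (hl : PolyTime l) :
    PolyTime fun x => decide ((l x).length ≤ k) := by
  have h := isEmpty (drop k hl)
  have e : ∀ x, decide ((l x).length ≤ k) = ((l x).drop k).isEmpty := fun x => by
    rw [Bool.eq_iff_iff]; simp [List.drop_eq_nil_iff]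
  simpa only [e] using h

end PolyTime

/-! ### The decision procedure on rational data -/

/-- A point with rational coordinates. -/
abbrev RatPoint := ℚ × ℚ

/-- A vertex, as its point together with its number. -/
abbrev DrawnVertex := RatPoint × ℕ

/-- An oriented edge: the two ends, whether it is drawn already, and its bends if it is. -/
abbrev EdgeItem := DrawnVertex × DrawnVertex × Bool × List RatPoint

/-- The lower left corner of the intersection of the boxes spanned by two pairs of points. -/
def boxLo (s t : RatPoint × RatPoint) : RatPoint := (s.1 ⊓ s.2) ⊔ (t.1 ⊓ t.2)

/-- The upper right corner of the intersection of the boxes spanned by two pairs of points. -/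
def boxHi (s t : RatPoint × RatPoint) : RatPoint := (s.1 ⊔ s.2) ⊓ (t.1 ⊔ t.2)

/-- Test for horizontal segments that are not single points. -/
def isHor (s : RatPoint × RatPoint) : Bool := decide (s.1.2 = s.2.2) && !decide (s.1.1 = s.2.1)

/-- Test for vertical segments that are not single points. -/
def isVer (s : RatPoint × RatPoint) : Bool := decide (s.1.1 = s.2.1) && !decide (s.1.2 = s.2.2)

/-- Test for orthogonal chains. -/
def orthogonalTest (l : List RatPoint) : Bool :=
  ((chainSegments l).all fun s => isHor s || isVer s) &&
  ((chainSegments l).zip (chainSegments l).tail).all fun p =>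
    (isHor p.1 && isVer p.2) || (isVer p.1 && isHor p.2)

/-- Test for simple chains, among the orthogonal ones. -/
def simpleTest (l : List RatPoint) : Bool :=
  (chainSegments l).zipIdx.all fun a => (chainSegments l).zipIdx.all fun b =>
    !decide (a.2 + 1 + 1 ≤ b.2) || !decide (boxLo a.1 b.1 ≤ boxHi a.1 b.1)

/-- Test that the edge `e`, drawn along the chain `l`, contains no vertices but its ends. -/
def vertexTest (pts : List DrawnVertex) (e : EdgeItem) (l : List RatPoint) : Bool :=
  pts.all fun w => (chainSegments l).all fun s =>
    !(decide (s.1 ⊓ s.2 ≤ w.1) && decide (w.1 ≤ s.1 ⊔ s.2)) ||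
      (decide (w = e.1) || decide (w = e.2.1))

/-- The two oriented edges are opposite orientations of the same edge. -/
def isOpposite (e f : EdgeItem) : Bool := decide (e.1 = f.2.1) && decide (e.2.1 = f.1)

/-- Test that two edges, drawn along the chains `l` and `l'`, meet in common ends only. -/
def meetTest (e f : EdgeItem) (l l' : List RatPoint) : Bool :=
  ((decide (e.1 = f.1) && decide (e.2.1 = f.2.1)) || isOpposite e f) ||
  (chainSegments l).all fun s => (chainSegments l').all fun t =>
    !decide (boxLo s t ≤ boxHi s t) || [e.1, e.2.1].any fun w =>
      (decide (w = f.1) || decide (w = f.2.1)) &&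
        (decide (boxLo s t = w.1) && decide (boxHi s t = w.1))

/-- The bends of the edge `x.1`, if it is drawn with at most `k ≤ 1` bends and `x.2` selects one
of the two routes with one bend. Only a straight route is possible if the ends are aligned. -/
def routeBends (k : ℕ) (x : EdgeItem × Bool) : List RatPoint :=
  bif x.1.2.2.1 then x.1.2.2.2
  else bif decide (k = 0) || (decide (x.1.1.1.1 = x.1.2.1.1.1) || decide (x.1.1.1.2 = x.1.2.1.1.2))
    then []
  else [bif x.2 then (x.1.2.1.1.1, x.1.1.1.2) else (x.1.1.1.1, x.1.2.1.1.2)]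

/-- The corners of the route of an edge. -/
def route (k : ℕ) (x : EdgeItem × Bool) : List RatPoint :=
  x.1.1.1 :: (routeBends k x ++ [x.1.2.1.1])

/-- The tests that concern one edge. The bound on the number of bends is not imposed on the edges
that are drawn already if `new` holds. -/
def routeTest (k : ℕ) (new : Bool) (pts : List DrawnVertex) (x : EdgeItem × Bool) : Bool :=
  ((new && x.1.2.2.1) || decide ((routeBends k x).length ≤ k)) &&
  (orthogonalTest (route k x) && (simpleTest (route k x) && vertexTest pts x.1 (route k x)))

/-- The tests that concern two edges. -/
def pairTest (k : ℕ) (x y : EdgeItem × Bool) : Bool :=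
  meetTest x.1 y.1 (route k x) (route k y) &&
    (!isOpposite x.1 y.1 || decide (routeBends k y = (routeBends k x).reverse))

/-- The routes of two edges cannot both be used. -/
def conflict (k : ℕ) (new : Bool) (pts : List DrawnVertex) (x y : EdgeItem × Bool) : Bool :=
  !((routeTest k new pts x && routeTest k new pts y) && (pairTest k x y && pairTest k y x))

/-- Both orientations of the edges, which are given by the numbers of their ends. -/
def edgeItems (pts : List DrawnVertex) (edges : List ((ℕ × ℕ) × Bool × List RatPoint)) :
    List EdgeItem :=
  edges.flatMap fun e => pts.flatMap fun a => pts.flatMap fun b =>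
    bif decide (a.2 = e.1.1) && decide (b.2 = e.1.2) then
      [(a, b, e.2.1, e.2.2), (b, a, e.2.1, e.2.2.reverse)]
    else []

/-- The decision procedure, for a list of points and a list of edges. The routes of the two
orientations of an edge are chosen separately; by `pairTest` they have to be reverse to each
other. -/
def extensionTest (k : ℕ) (new : Bool)
    (d : List RatPoint × List ((ℕ × ℕ) × Bool × List RatPoint)) : Bool :=
  satisfiable (edgeItems d.1.zipIdx d.2) (conflict k new d.1.zipIdx)

namespace PolyTime

variable {ξ : Type} [TreeEnc ξ]

@[fun_prop]
theorem point_inf {f g : ξ → RatPoint} (hf : PolyTime f) (hg : PolyTime g) :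
    PolyTime fun x => f x ⊓ g x := by
  have h : PolyTime fun x => (if (f x).1 ≤ (g x).1 then (f x).1 else (g x).1,
      if (f x).2 ≤ (g x).2 then (f x).2 else (g x).2) := by fun_prop
  simp only [← min_def] at h
  exact h

@[fun_prop]
theorem point_sup {f g : ξ → RatPoint} (hf : PolyTime f) (hg : PolyTime g) :
    PolyTime fun x => f x ⊔ g x := by
  have h : PolyTime fun x => (if (f x).1 ≤ (g x).1 then (g x).1 else (f x).1,
      if (f x).2 ≤ (g x).2 then (g x).2 else (f x).2) := by fun_prop
  simp only [← max_def] at h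
  exact h

@[fun_prop]
theorem point_le {f g : ξ → RatPoint} [DecidablePred fun x => f x ≤ g x]
    (hf : PolyTime f) (hg : PolyTime g) : PolyTime fun x => decide (f x ≤ g x) := by
  have h : PolyTime fun x => decide ((f x).1 ≤ (g x).1) && decide ((f x).2 ≤ (g x).2) := by fun_prop
  convert h using 2 with x
  rw [Bool.eq_iff_iff]
  simp [Prod.le_def]

@[fun_prop]
theorem chainSegments {f : ξ → List RatPoint} (hf : PolyTime f) :
    PolyTime fun x => chainSegments (f x) := by
  unfold _root_.chainSegments
  fun_prop

@[fun_prop]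
theorem boxLo {f g : ξ → RatPoint × RatPoint} (hf : PolyTime f) (hg : PolyTime g) :
    PolyTime fun x => boxLo (f x) (g x) := by
  unfold _root_.boxLo
  fun_prop

@[fun_prop]
theorem boxHi {f g : ξ → RatPoint × RatPoint} (hf : PolyTime f) (hg : PolyTime g) :
    PolyTime fun x => boxHi (f x) (g x) := by
  unfold _root_.boxHi
  fun_prop

@[fun_prop]
theorem orthogonalTest {f : ξ → List RatPoint} (hf : PolyTime f) :
    PolyTime fun x => orthogonalTest (f x) := by
  unfold _root_.orthogonalTest isHor isVer
  fun_prop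

@[fun_prop]
theorem simpleTest {f : ξ → List RatPoint} (hf : PolyTime f) :
    PolyTime fun x => simpleTest (f x) := by
  unfold _root_.simpleTest
  fun_prop

@[fun_prop]
theorem vertexTest {p : ξ → List DrawnVertex} {e : ξ → EdgeItem} {f : ξ → List RatPoint}
    (hp : PolyTime p) (he : PolyTime e) (hf : PolyTime f) :
    PolyTime fun x => vertexTest (p x) (e x) (f x) := by
  unfold _root_.vertexTest
  fun_prop

@[fun_prop]
theorem isOpposite {e f : ξ → EdgeItem} (he : PolyTime e) (hf : PolyTime f) :
    PolyTime fun x => isOpposite (e x) (f x) := by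
  unfold _root_.isOpposite
  fun_prop

@[fun_prop]
theorem meetTest {e f : ξ → EdgeItem} {l l' : ξ → List RatPoint} (he : PolyTime e)
    (hf : PolyTime f) (hl : PolyTime l) (hl' : PolyTime l') :
    PolyTime fun x => meetTest (e x) (f x) (l x) (l' x) := by
  unfold _root_.meetTest
  fun_prop

@[fun_prop]
theorem routeBends (k : ℕ) {y : ξ → EdgeItem × Bool} (hy : PolyTime y) :
    PolyTime fun x => routeBends k (y x) := by
  unfold _root_.routeBends
  fun_prop

@[fun_prop]
theorem route (k : ℕ) {y : ξ → EdgeItem × Bool} (hy : PolyTime y) :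
    PolyTime fun x => route k (y x) := by
  unfold _root_.route
  fun_prop

theorem conflict (k : ℕ) (new : Bool) {p : ξ → List DrawnVertex} {y z : ξ → EdgeItem × Bool}
    (hp : PolyTime p) (hy : PolyTime y) (hz : PolyTime z) :
    PolyTime fun x => conflict k new (p x) (y x) (z x) := by
  unfold _root_.conflict routeTest pairTest
  fun_prop

theorem edgeItems {p : ξ → List DrawnVertex} {e : ξ → List ((ℕ × ℕ) × Bool × List RatPoint)}
    (hp : PolyTime p) (he : PolyTime e) : PolyTime fun x => edgeItems (p x) (e x) := by
  unfold _root_.edgeItems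
  fun_prop

theorem extensionTest (k : ℕ) (new : Bool) : PolyTime (extensionTest k new) :=
  satisfiable (edgeItems (by fun_prop) (by fun_prop))
    (conflict k new (by fun_prop) (by fun_prop) (by fun_prop))

end PolyTime

/-! ### Correctness of the geometric tests -/

/-- A rational point as a point of the real plane. -/
def castPoint : RatPoint → ℝ × ℝ := Prod.map (fun q : ℚ => (q : ℝ)) (fun q : ℚ => (q : ℝ))

theorem castPoint_injective : Function.Injective castPoint :=
  Function.Injective.prodMap Rat.cast_injective Rat.cast_injective

@[simp] theorem castPoint_le {p q : RatPoint} : castPoint p ≤ castPoint q ↔ p ≤ q := by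
  simp [castPoint, Prod.le_def]

theorem castPoint_inf (p q : RatPoint) : castPoint (p ⊓ q) = castPoint p ⊓ castPoint q :=
  Prod.ext (Rat.cast_min _ _) (Rat.cast_min _ _)

theorem castPoint_sup (p q : RatPoint) : castPoint (p ⊔ q) = castPoint p ⊔ castPoint q :=
  Prod.ext (Rat.cast_max _ _) (Rat.cast_max _ _)

theorem chainSegments_map {𝕜 𝕜' : Type} (f : 𝕜 × 𝕜 → 𝕜' × 𝕜') (l : List (𝕜 × 𝕜)) :
    chainSegments (l.map f) = (chainSegments l).map (Prod.map f f) := by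
  rw [chainSegments, chainSegments, ← List.map_tail, List.zip_map]

/-- A segment that is parallel to an axis is a degenerate box. -/
theorem segment_eq_box {s : (ℝ × ℝ) × (ℝ × ℝ)} (h : IsHorizontal s ∨ IsVertical s) :
    segment ℝ s.1 s.2 = Set.Icc (s.1 ⊓ s.2) (s.1 ⊔ s.2) := by
  obtain ⟨⟨a, b⟩, ⟨c, d⟩⟩ := s
  rcases h with ⟨h, _⟩ | ⟨h, _⟩
  · obtain rfl : b = d := h
    change segment ℝ (a, b) (c, b) = _
    rw [← Prod.image_mk_segment_left, segment_eq_uIcc]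
    ext ⟨x, y⟩
    simp [Set.uIcc, Prod.le_def]
    constructor
    · rintro ⟨⟨h₁, h₂⟩, rfl⟩; simp [h₁, h₂]
    · rintro ⟨⟨h₁, h₂⟩, h₃, h₄⟩; exact ⟨⟨h₁, h₃⟩, le_antisymm h₂ h₄⟩
  · obtain rfl : a = c := h
    change segment ℝ (a, b) (a, d) = _
    rw [← Prod.image_mk_segment_right, segment_eq_uIcc]
    ext ⟨x, y⟩
    simp [Set.uIcc, Prod.le_def]
    constructor
    · rintro ⟨⟨h₁, h₂⟩, rfl⟩; simp [h₁, h₂]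
    · rintro ⟨⟨h₁, h₂⟩, h₃, h₄⟩; exact ⟨⟨h₂, h₄⟩, le_antisymm h₁ h₃⟩

/-- A rational segment in the real plane. -/
def castSegment : RatPoint × RatPoint → (ℝ × ℝ) × (ℝ × ℝ) := Prod.map castPoint castPoint

theorem isHorizontal_castSegment (s : RatPoint × RatPoint) :
    IsHorizontal (castSegment s) ↔ isHor s = true := by
  simp [IsHorizontal, isHor, castSegment, castPoint]

theorem isVertical_castSegment (s : RatPoint × RatPoint) :
    IsVertical (castSegment s) ↔ isVer s = true := by
  simp [IsVertical, isVer, castSegment, castPoint]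

theorem segment_castSegment {s : RatPoint × RatPoint} (h : isHor s = true ∨ isVer s = true) :
    segment ℝ (castSegment s).1 (castSegment s).2 =
      Set.Icc (castPoint (s.1 ⊓ s.2)) (castPoint (s.1 ⊔ s.2)) := by
  rw [← isHorizontal_castSegment, ← isVertical_castSegment] at h
  rw [segment_eq_box h, castPoint_inf, castPoint_sup]
  rfl

theorem segment_inter_segment {s t : RatPoint × RatPoint} (hs : isHor s = true ∨ isVer s = true)
    (ht : isHor t = true ∨ isVer t = true) :
    segment ℝ (castSegment s).1 (castSegment s).2 ∩ segment ℝ (castSegment t).1 (castSegment t).2 =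
      Set.Icc (castPoint (boxLo s t)) (castPoint (boxHi s t)) := by
  rw [segment_castSegment hs, segment_castSegment ht, Set.Icc_inter_Icc, boxLo, boxHi,
    castPoint_sup (s.1 ⊓ s.2), castPoint_inf (s.1 ⊔ s.2)]

theorem isOrthogonalChain_iff (l : List RatPoint) :
    IsOrthogonalChain (l.map castPoint) ↔ orthogonalTest l = true := by
  have hpair : ∀ (z : List (RatPoint × RatPoint))
      (p : RatPoint × RatPoint → RatPoint × RatPoint → Prop),
      (∀ q ∈ z.zip z.tail, p q.1 q.2) ↔
        ∀ (i : ℕ) s t, z[i]? = some s → z[i + 1]? = some t → p s t := by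
    intro z p
    constructor
    · intro h i s t hs ht
      refine h (s, t) (List.mem_iff_getElem?.2 ⟨i, ?_⟩)
      rw [List.getElem?_zip_eq_some]
      exact ⟨hs, by simpa using ht⟩
    · intro h q hq
      obtain ⟨i, hi⟩ := List.mem_iff_getElem?.1 hq
      rw [List.getElem?_zip_eq_some] at hi
      exact h i _ _ hi.1 (by simpa using hi.2)
  rw [IsOrthogonalChain, orthogonalTest, chainSegments_map, Bool.and_eq_true, List.all_eq_true,
    List.all_eq_true, hpair (chainSegments l)
      (fun s t => ((isHor s && isVer t) || (isVer s && isHor t)) = true)]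
  change (∀ s ∈ (chainSegments l).map castSegment, _) ∧ (∀ i s t,
    ((chainSegments l).map castSegment)[i]? = some s →
    ((chainSegments l).map castSegment)[i + 1]? = some t → _) ↔ _
  simp only [List.mem_map, forall_exists_index, and_imp, forall_apply_eq_imp_iff₂,
    List.getElem?_map, Option.map_eq_some_iff, isHorizontal_castSegment, isVertical_castSegment,
    Bool.or_eq_true, Bool.and_eq_true]
  refine and_congr Iff.rfl ⟨fun h i s t hs ht => ?_, fun h i s t s' hs e t' ht e' => ?_⟩
  · simpa only [isHorizontal_castSegment, isVertical_castSegment] using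
      h i _ _ s hs rfl t ht rfl
  · subst e e'
    simpa only [isHorizontal_castSegment, isVertical_castSegment] using h i s' t' hs ht

theorem orthogonalTest_segment {l : List RatPoint} (h : orthogonalTest l = true)
    {s : RatPoint × RatPoint} (hs : s ∈ chainSegments l) : isHor s = true ∨ isVer s = true := by
  rw [orthogonalTest, Bool.and_eq_true, List.all_eq_true] at h
  simpa using h.1 s hs

theorem isSimpleChain_iff {l : List RatPoint} (h : orthogonalTest l = true) :
    IsSimpleChain (l.map castPoint) ↔ simpleTest l = true := by
  have hdisj : ∀ s ∈ chainSegments l, ∀ t ∈ chainSegments l,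
      (Disjoint (segment ℝ (castSegment s).1 (castSegment s).2)
        (segment ℝ (castSegment t).1 (castSegment t).2) ↔ ¬ boxLo s t ≤ boxHi s t) := by
    intro s hs t ht
    rw [Set.disjoint_iff_inter_eq_empty, segment_inter_segment (orthogonalTest_segment h hs)
      (orthogonalTest_segment h ht), Set.Icc_eq_empty_iff, castPoint_le]
  rw [IsSimpleChain, simpleTest, chainSegments_map]
  change (∀ i j s t, i + 1 < j → ((chainSegments l).map castSegment)[i]? = some s →
    ((chainSegments l).map castSegment)[j]? = some t → _) ↔ _
  simp only [List.all_eq_true, List.mem_zipIdx_iff_getElem?, Bool.or_eq_true,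
    Bool.not_eq_true', decide_eq_false_iff_not, List.getElem?_map, Option.map_eq_some_iff]
  constructor
  · rintro H ⟨s, i⟩ hs ⟨t, j⟩ ht
    by_cases hij : i + 1 + 1 ≤ j
    · exact .inr ((hdisj s (List.mem_of_getElem? hs) t (List.mem_of_getElem? ht)).1
        (H i j _ _ hij ⟨s, hs, rfl⟩ ⟨t, ht, rfl⟩))
    · exact .inl hij
  · rintro H i j _ _ hij ⟨s, hs, rfl⟩ ⟨t, ht, rfl⟩
    exact (hdisj s (List.mem_of_getElem? hs) t (List.mem_of_getElem? ht)).2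
      ((H (s, i) hs (t, j) ht).resolve_left (not_not.2 hij))

theorem mem_chainTrace_iff {l : List RatPoint} (p : ℝ × ℝ) :
    p ∈ chainTrace (l.map castPoint) ↔
      ∃ s ∈ chainSegments l, p ∈ segment ℝ (castSegment s).1 (castSegment s).2 := by
  rw [chainTrace, chainSegments_map]
  constructor
  · rintro ⟨_, hs, hp⟩
    obtain ⟨s, hs', rfl⟩ := List.mem_map.1 hs
    exact ⟨s, hs', hp⟩
  · rintro ⟨s, hs, hp⟩
    exact ⟨_, List.mem_map_of_mem hs, hp⟩

theorem vertexTest_iff {l : List RatPoint} (h : orthogonalTest l = true) (pts : List DrawnVertex)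
    (e : EdgeItem) : vertexTest pts e l = true ↔
      ∀ w ∈ pts, castPoint w.1 ∈ chainTrace (l.map castPoint) → w = e.1 ∨ w = e.2.1 := by
  simp only [vertexTest, List.all_eq_true, mem_chainTrace_iff, Bool.or_eq_true, Bool.not_eq_true',
    Bool.and_eq_false_iff, decide_eq_false_iff_not, decide_eq_true_iff]
  refine forall₂_congr fun w _ => ⟨?_, ?_⟩
  · rintro H ⟨s, hs, hw⟩
    rw [segment_castSegment (orthogonalTest_segment h hs), Set.mem_Icc, castPoint_le,
      castPoint_le] at hw
    exact (H s hs).resolve_left (by tauto)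
  · intro H s hs
    by_contra! hcon
    refine absurd (H ⟨s, hs, ?_⟩) (by tauto)
    rw [segment_castSegment (orthogonalTest_segment h hs), Set.mem_Icc, castPoint_le, castPoint_le]
    exact hcon.1

/-- If two edges are different, then they have at most one common end, and so two of their
segments that meet in common ends only meet in a single point. -/
theorem meetTest_iff {l l' : List RatPoint} (h : orthogonalTest l = true)
    (h' : orthogonalTest l' = true) (e f : EdgeItem) (he : e.1 ≠ e.2.1) : meetTest e f l l' = true ↔
      (¬ (e.1 = f.1 ∧ e.2.1 = f.2.1 ∨ e.1 = f.2.1 ∧ e.2.1 = f.1) →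
        ∀ p ∈ chainTrace (l.map castPoint), p ∈ chainTrace (l'.map castPoint) →
          ∃ w : DrawnVertex,
            (w = e.1 ∨ w = e.2.1) ∧ (w = f.1 ∨ w = f.2.1) ∧ p = castPoint w.1) := by
  rw [meetTest, isOpposite, Bool.or_eq_true, Bool.or_eq_true, Bool.and_eq_true, Bool.and_eq_true,
    decide_eq_true_iff, decide_eq_true_iff, decide_eq_true_iff, decide_eq_true_iff]
  by_cases hsame : e.1 = f.1 ∧ e.2.1 = f.2.1 ∨ e.1 = f.2.1 ∧ e.2.1 = f.1
  · simp [hsame]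
  simp only [hsame, false_or, not_false_eq_true, true_imp_iff, mem_chainTrace_iff,
    List.all_eq_true, List.any_eq_true, Bool.or_eq_true, Bool.and_eq_true, Bool.not_eq_true',
    decide_eq_false_iff_not, decide_eq_true_iff, List.mem_cons, List.not_mem_nil, or_false]
  constructor
  · rintro H p ⟨s, hs, hp⟩ ⟨t, ht, hp'⟩
    have hmem : p ∈ Set.Icc (castPoint (boxLo s t)) (castPoint (boxHi s t)) := by
      rw [← segment_inter_segment (orthogonalTest_segment h hs) (orthogonalTest_segment h' ht)]
      exact ⟨hp, hp'⟩
    have hle : boxLo s t ≤ boxHi s t := by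
      rw [← castPoint_le]
      exact hmem.1.trans hmem.2
    obtain ⟨w, hw, hw', h₁, h₂⟩ := (H s hs t ht).resolve_left (not_not.2 hle)
    rw [h₁, h₂] at hmem
    exact ⟨w, hw, hw', le_antisymm hmem.2 hmem.1⟩
  · intro H s hs t ht
    by_cases hle : boxLo s t ≤ boxHi s t
    · right
      have hbox := segment_inter_segment (orthogonalTest_segment h hs)
        (orthogonalTest_segment h' ht)
      have key : ∀ p : RatPoint, boxLo s t ≤ p → p ≤ boxHi s t →
          ∃ w : DrawnVertex, (w = e.1 ∨ w = e.2.1) ∧ (w = f.1 ∨ w = f.2.1) ∧ p = w.1 := by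
        intro p h₁ h₂
        have hp : castPoint p ∈ Set.Icc (castPoint (boxLo s t)) (castPoint (boxHi s t)) :=
          ⟨castPoint_le.2 h₁, castPoint_le.2 h₂⟩
        rw [← hbox] at hp
        obtain ⟨w, hw, hw', hpw⟩ := H _ ⟨s, hs, hp.1⟩ ⟨t, ht, hp.2⟩
        exact ⟨w, hw, hw', castPoint_injective hpw⟩
      obtain ⟨w, hw, hw', hlo⟩ := key _ le_rfl hle
      obtain ⟨v, hv, hv', hhi⟩ := key _ hle le_rfl
      have hwv : w = v := by
        by_contra hne
        apply hsame
        rcases hw with rfl | rfl <;> rcases hv with rfl | rfl <;>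
          rcases hw' with hw' | hw' <;> rcases hv' with hv' | hv' <;> simp_all
      subst hwv
      exact ⟨w, hw, hw', hlo, hhi⟩
    · exact .inl hle

/-! ### Correctness of the decision procedure -/

namespace RepExtInstance

variable (I : RepExtInstance)

/-- A vertex of the instance with its given point. -/
def drawnVertex (v : Fin I.n) : DrawnVertex := (I.drawing.pos v, (v : ℕ))

theorem drawnVertex_injective : Function.Injective I.drawnVertex := fun u v h => by
  simpa [drawnVertex, Fin.ext_iff] using (congrArg Prod.snd h : _)

open Classical in
/-- The bends of an edge that is drawn already. -/
noncomputable def givenBends (u v : Fin I.n) : List RatPoint :=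
  if I.H.Adj u v then I.drawing.bends u v else []

open Classical in
/-- The ordered pair `uv` as an oriented edge. -/
noncomputable def edgeItem (u v : Fin I.n) : EdgeItem :=
  (I.drawnVertex u, I.drawnVertex v, decide (I.H.Adj u v), I.givenBends u v)

theorem edgeItem_inj {u v u' v' : Fin I.n} (h : I.edgeItem u v = I.edgeItem u' v') :
    u = u' ∧ v = v' := by
  simp only [edgeItem, Prod.mk.injEq] at h
  exact ⟨I.drawnVertex_injective h.1, I.drawnVertex_injective h.2.1⟩

/-- All vertices with their points. -/
def drawnVertices : List DrawnVertex := ((List.finRange I.n).map I.drawing.pos).zipIdx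

theorem mem_drawnVertices (x : DrawnVertex) : x ∈ I.drawnVertices ↔ ∃ v, x = I.drawnVertex v := by
  obtain ⟨p, i⟩ := x
  rw [drawnVertices, List.mem_zipIdx_iff_getElem?, List.getElem?_map, Option.map_eq_some_iff]
  constructor
  · rintro ⟨v, hv, rfl⟩
    obtain ⟨h, hv⟩ := List.getElem?_eq_some_iff.1 hv
    exact ⟨v, Prod.ext rfl (by simpa [drawnVertex] using congrArg Fin.val hv)⟩
  · rintro ⟨v, hv⟩
    simp only [drawnVertex, Prod.mk.injEq] at hv
    obtain ⟨rfl, rfl⟩ := hv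
    exact ⟨v, by simp, rfl⟩

theorem bends_reverse {u v : Fin I.n} (h : I.H.Adj u v) :
    I.drawing.bends v u = (I.drawing.bends u v).reverse := by
  have h := I.planar.bends_symm u v h
  change (I.drawing.bends v u).map castPoint = ((I.drawing.bends u v).map castPoint).reverse at h
  rw [← List.map_reverse] at h
  exact (List.map_injective_iff.2 castPoint_injective) h

theorem givenBends_swap (u v : Fin I.n) : I.givenBends v u = (I.givenBends u v).reverse := by
  by_cases h : I.H.Adj u v
  · simp [givenBends, h, h.symm, I.bends_reverse h]
  · have h' : ¬ I.H.Adj v u := fun h' => h h'.symm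
    simp [givenBends, h, h']

open Classical in
/-- The edges of the instance, given by the numbers of their ends. -/
noncomputable def edgeData : List ((ℕ × ℕ) × Bool × List RatPoint) :=
  I.edgeList.map fun e => (((e.1 : ℕ), (e.2 : ℕ)), decide (I.H.Adj e.1 e.2), I.givenBends e.1 e.2)

theorem mem_edgeItems (x : EdgeItem) : x ∈ edgeItems I.drawnVertices I.edgeData ↔
    ∃ u v, I.G.Adj u v ∧ x = I.edgeItem u v := by
  classical
  have hswap : ∀ u v : Fin I.n, (I.drawnVertex v, I.drawnVertex u, decide (I.H.Adj u v),
      (I.givenBends u v).reverse) = I.edgeItem v u := by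
    intro u v
    rw [← I.givenBends_swap, edgeItem]
    congr 3
    exact decide_eq_decide.2 ⟨fun h => h.symm, fun h => h.symm⟩
  have hmem : ∀ u v, (u, v) ∈ I.edgeList ↔ u < v ∧ I.G.Adj u v := by
    simp [edgeList]
  simp only [edgeItems, edgeData, List.mem_flatMap, List.mem_map, mem_drawnVertices]
  constructor
  · rintro ⟨_, ⟨⟨u, v⟩, huv, rfl⟩, _, ⟨a, rfl⟩, _, ⟨b, rfl⟩, hx⟩
    obtain ⟨-, huv⟩ := (hmem u v).1 huv
    by_cases hab : a = u ∧ b = v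
    · obtain ⟨rfl, rfl⟩ := hab
      simp only [drawnVertex, decide_true, Bool.and_self, cond_true, List.mem_cons,
        List.not_mem_nil, or_false] at hx
      rcases hx with rfl | rfl
      · exact ⟨a, b, huv, rfl⟩
      · exact ⟨b, a, huv.symm, hswap a b⟩
    · have : (decide ((I.drawnVertex a).2 = (u : ℕ)) && decide ((I.drawnVertex b).2 = (v : ℕ))) =
          false := by
        simp only [drawnVertex, Fin.val_inj, Bool.and_eq_false_iff, decide_eq_false_iff_not]
        tauto
      simp [this] at hx
  · rintro ⟨u, v, huv, rfl⟩
    rcases lt_or_gt_of_ne huv.ne with h | h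
    · exact ⟨_, ⟨(u, v), (hmem u v).2 ⟨h, huv⟩, rfl⟩, _, ⟨u, rfl⟩, _, ⟨v, rfl⟩,
        by simp [drawnVertex, edgeItem]⟩
    · exact ⟨_, ⟨(v, u), (hmem v u).2 ⟨h, huv.symm⟩, rfl⟩, _, ⟨v, rfl⟩, _, ⟨u, rfl⟩,
        by rw [← hswap v u]; simp [drawnVertex]⟩

/-- For a drawing with rational bends of all edges, the tests are equivalent to planarity. -/
theorem planar_iff (hV : I.H.verts = Set.univ) {D : DrawingData ℝ (Fin I.n)}
    {B : Fin I.n → Fin I.n → List RatPoint} (hpos : ∀ v, D.pos v = castPoint (I.drawing.pos v))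
    (hB : ∀ u v, I.G.Adj u v → D.bends u v = (B u v).map castPoint) :
    IsPlanarOrthogonalDrawing (⊤ : I.G.Subgraph) D ↔
      (∀ u v, I.G.Adj u v →
        orthogonalTest (I.drawing.pos u :: (B u v ++ [I.drawing.pos v])) = true ∧
        simpleTest (I.drawing.pos u :: (B u v ++ [I.drawing.pos v])) = true ∧
        vertexTest I.drawnVertices (I.edgeItem u v)
          (I.drawing.pos u :: (B u v ++ [I.drawing.pos v])) = true) ∧
      (∀ u v u' v', I.G.Adj u v → I.G.Adj u' v' →
        meetTest (I.edgeItem u v) (I.edgeItem u' v')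
          (I.drawing.pos u :: (B u v ++ [I.drawing.pos v]))
          (I.drawing.pos u' :: (B u' v' ++ [I.drawing.pos v'])) = true) ∧
      (∀ u v, I.G.Adj u v → B v u = (B u v).reverse) := by
  have hchain : ∀ u v, I.G.Adj u v →
      D.chain u v = (I.drawing.pos u :: (B u v ++ [I.drawing.pos v])).map castPoint := by
    intro u v h
    simp [DrawingData.chain, hpos, hB u v h]
  have hinj := I.drawnVertex_injective
  have hne : ∀ {u v}, I.G.Adj u v → (I.edgeItem u v).1 ≠ (I.edgeItem u v).2.1 :=
    fun h h' => h.ne (hinj h')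
  have hvert : ∀ {u v}, orthogonalTest (I.drawing.pos u :: (B u v ++ [I.drawing.pos v])) = true →
      I.G.Adj u v → (vertexTest I.drawnVertices (I.edgeItem u v)
          (I.drawing.pos u :: (B u v ++ [I.drawing.pos v])) = true ↔
        ∀ w, D.pos w ∈ chainTrace (D.chain u v) → w = u ∨ w = v) := by
    intro u v ho h
    rw [vertexTest_iff ho, hchain u v h]
    simp only [mem_drawnVertices, forall_exists_index, forall_eq_apply_imp_iff, edgeItem,
      hinj.eq_iff, hpos]
    rfl
  have hmeet : ∀ {u v u' v'}, I.G.Adj u v → I.G.Adj u' v' →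
      orthogonalTest (I.drawing.pos u :: (B u v ++ [I.drawing.pos v])) = true →
      orthogonalTest (I.drawing.pos u' :: (B u' v' ++ [I.drawing.pos v'])) = true →
      (meetTest (I.edgeItem u v) (I.edgeItem u' v')
          (I.drawing.pos u :: (B u v ++ [I.drawing.pos v]))
          (I.drawing.pos u' :: (B u' v' ++ [I.drawing.pos v'])) = true ↔
        (s(u, v) ≠ s(u', v') → ∀ p, p ∈ chainTrace (D.chain u v) →
          p ∈ chainTrace (D.chain u' v') → ∃ w, w ∈ s(u, v) ∧ w ∈ s(u', v') ∧ p = D.pos w)) := by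
    intro u v u' v' h h' ho ho'
    rw [meetTest_iff ho ho' _ _ (hne h), hchain u v h, hchain u' v' h']
    simp only [edgeItem, hinj.eq_iff, ne_eq, Sym2.eq_iff, Sym2.mem_iff]
    refine imp_congr_right fun _ => forall₃_congr fun p _ _ => ?_
    constructor
    · rintro ⟨w, hw, hw', rfl⟩
      rcases hw with rfl | rfl
      · exact ⟨u, .inl rfl, by simpa [hinj.eq_iff] using hw', (hpos _).symm⟩
      · exact ⟨v, .inr rfl, by simpa [hinj.eq_iff] using hw', (hpos _).symm⟩
    · rintro ⟨w, hw, hw', rfl⟩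
      exact ⟨I.drawnVertex w, by simpa [hinj.eq_iff] using hw, by simpa [hinj.eq_iff] using hw',
        hpos w⟩
  constructor
  · intro hD
    have ho : ∀ u v, I.G.Adj u v →
        orthogonalTest (I.drawing.pos u :: (B u v ++ [I.drawing.pos v])) = true := by
      intro u v h
      rw [← isOrthogonalChain_iff, ← hchain u v h]
      exact hD.orthogonal u v h
    refine ⟨fun u v h => ⟨ho u v h, ?_, ?_⟩, fun u v u' v' h h' => ?_, fun u v h => ?_⟩
    · rw [← isSimpleChain_iff (ho u v h), ← hchain u v h]
      exact hD.simple u v h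
    · rw [hvert (ho u v h) h]
      exact fun w => hD.vertex_on_edge u v w h trivial
    · rw [hmeet h h' (ho u v h) (ho u' v' h')]
      exact hD.edge_meet u v u' v' h h'
    · have := hD.bends_symm u v h
      rw [hB u v h, hB v u h.symm, ← List.map_reverse] at this
      exact (List.map_injective_iff.2 castPoint_injective) this
  · rintro ⟨H₁, H₂, H₃⟩
    refine ⟨fun u v h => ?_, fun u _ v _ h => ?_, fun u v h => ?_, fun u v h => ?_,
      fun u v w h _ => ?_, fun u v u' v' h h' => ?_⟩
    · rw [hB u v h, hB v u h.symm, H₃ u v h, List.map_reverse]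
    · refine I.planar.pos_injOn (hV ▸ trivial) (hV ▸ trivial) ?_
      change castPoint _ = castPoint _
      rw [← hpos, ← hpos, h]
    · rw [hchain u v h, isOrthogonalChain_iff]
      exact (H₁ u v h).1
    · rw [hchain u v h, isSimpleChain_iff (H₁ u v h).1]
      exact (H₁ u v h).2.1
    · exact (hvert (H₁ u v h).1 h).1 (H₁ u v h).2.2 w
    · exact (hmeet h h' (H₁ u v h).1 (H₁ u' v' h').1).1 (H₂ u v u' v' h h')

theorem routeBends_edgeItem_of_adj (k : ℕ) {u v : Fin I.n} (h : I.H.Adj u v) (b : Bool) :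
    routeBends k (I.edgeItem u v, b) = I.drawing.bends u v := by
  simp [routeBends, edgeItem, givenBends, h]

/-- A new edge with at most `k ≤ 1` bends follows one of its two routes. -/
theorem exists_routeBends {k : ℕ} (hk : k = 0 ∨ k = 1) {u v : Fin I.n} (h : ¬ I.H.Adj u v)
    {D : DrawingData ℝ (Fin I.n)} (hpos : ∀ v, D.pos v = castPoint (I.drawing.pos v))
    (ho : IsOrthogonalChain (D.chain u v)) (hl : (D.bends u v).length ≤ k) :
    ∃ b, D.bends u v = (routeBends k (I.edgeItem u v, b)).map castPoint := by
  obtain ⟨h₁, h₂⟩ := ho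
  simp only [routeBends, edgeItem, h, decide_false, cond_false, drawnVertex]
  generalize hpu : I.drawing.pos u = pu
  generalize hpv : I.drawing.pos v = pv
  obtain ⟨xu, yu⟩ := pu
  obtain ⟨xv, yv⟩ := pv
  have hu : D.pos u = ((xu : ℝ), (yu : ℝ)) := by rw [hpos, hpu]; rfl
  have hv : D.pos v = ((xv : ℝ), (yv : ℝ)) := by rw [hpos, hpv]; rfl
  rw [DrawingData.chain, hu, hv] at h₁ h₂
  rcases hb : D.bends u v with _ | ⟨p, _ | ⟨q, l⟩⟩
  · refine ⟨true, ?_⟩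
    have h₃ := h₁ ((xu, yu), (xv, yv)) (by simp [hb, chainSegments])
    have h₄ : xu = xv ∨ yu = yv := by
      rcases h₃ with h₃ | h₃
      · exact .inr (Rat.cast_injective h₃.1)
      · exact .inl (Rat.cast_injective h₃.1)
    have h₅ : (decide (xu = xv) || decide (yu = yv)) = true := by simpa using h₄
    simp [h₅]
  · have hk : k = 1 := by
      rw [hb] at hl
      simp at hl
      omega
    have h₃ := h₂ 0 ((xu, yu), p) (p, (xv, yv)) (by simp [hb, chainSegments])
      (by simp [hb, chainSegments])
    simp only [IsHorizontal, IsVertical, ne_eq] at h₃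
    obtain ⟨x, y⟩ := p
    rcases h₃ with ⟨⟨h₃, h₄⟩, h₅, h₆⟩ | ⟨⟨h₃, h₄⟩, h₅, h₆⟩
    · refine ⟨true, ?_⟩
      dsimp only at h₃ h₄ h₅ h₆
      subst h₃ h₅
      have h₇ : xu ≠ xv := fun e => h₄ (congrArg _ e)
      have h₈ : yu ≠ yv := fun e => h₆ (congrArg _ e)
      simp [hk, h₇, h₈, castPoint]
    · refine ⟨false, ?_⟩
      dsimp only at h₃ h₄ h₅ h₆
      subst h₃ h₅
      have h₇ : xu ≠ xv := fun e => h₆ (congrArg _ e)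
      have h₈ : yu ≠ yv := fun e => h₄ (congrArg _ e)
      simp [hk, h₇, h₈, castPoint]
  · rw [hb] at hl
    simp at hl
    omega

theorem conflict_comm (k : ℕ) (new : Bool) (pts : List DrawnVertex) (x y : EdgeItem × Bool) :
    conflict k new pts x y = conflict k new pts y x := by
  rw [conflict, conflict, Bool.and_comm (routeTest k new pts x), Bool.and_comm (pairTest k x y)]

/-- The decision procedure is correct. -/
theorem extensionTest_iff (hV : I.H.verts = Set.univ) {k : ℕ} (hk : k = 0 ∨ k = 1) (new : Bool) :
    extensionTest k new ((List.finRange I.n).map I.drawing.pos, I.edgeData) = true ↔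
      ∃ D : DrawingData ℝ (Fin I.n), I.IsExtension D ∧
        ∀ u v, I.G.Adj u v → (new = true → ¬ I.H.Adj u v) → (D.bends u v).length ≤ k := by
  classical
  rw [extensionTest, satisfiable_iff _ _ (conflict_comm k new _)]
  change (∃ c : EdgeItem → Bool, ∀ e ∈ edgeItems I.drawnVertices I.edgeData,
    ∀ f ∈ edgeItems I.drawnVertices I.edgeData,
      conflict k new I.drawnVertices (e, c e) (f, c f) = false) ↔ _
  have hinj := I.drawnVertex_injective
  have hconf : ∀ c : EdgeItem → Bool, (∀ e ∈ edgeItems I.drawnVertices I.edgeData,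
      ∀ f ∈ edgeItems I.drawnVertices I.edgeData,
        conflict k new I.drawnVertices (e, c e) (f, c f) = false) ↔
      (∀ u v, I.G.Adj u v →
        routeTest k new I.drawnVertices (I.edgeItem u v, c (I.edgeItem u v)) = true) ∧
      (∀ u v u' v', I.G.Adj u v → I.G.Adj u' v' →
        pairTest k (I.edgeItem u v, c (I.edgeItem u v))
          (I.edgeItem u' v', c (I.edgeItem u' v')) = true) := by
    intro c
    simp only [mem_edgeItems, conflict, Bool.not_eq_false', Bool.and_eq_true]
    constructor
    · intro h
      exact ⟨fun u v huv => (h _ ⟨u, v, huv, rfl⟩ _ ⟨u, v, huv, rfl⟩).1.1,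
        fun u v u' v' huv huv' => (h _ ⟨u, v, huv, rfl⟩ _ ⟨u', v', huv', rfl⟩).2.1⟩
    · rintro ⟨h₁, h₂⟩ _ ⟨u, v, huv, rfl⟩ _ ⟨u', v', huv', rfl⟩
      exact ⟨⟨h₁ u v huv, h₁ u' v' huv'⟩, h₂ u v u' v' huv huv', h₂ u' v' u v huv' huv⟩
  -- The tests for a choice of routes, in terms of the drawing that the choice gives.
  have hdraw : ∀ (c : EdgeItem → Bool) (D : DrawingData ℝ (Fin I.n)),
      (∀ v, D.pos v = castPoint (I.drawing.pos v)) →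
      (∀ u v, I.G.Adj u v → D.bends u v =
        (routeBends k (I.edgeItem u v, c (I.edgeItem u v))).map castPoint) →
      (((∀ u v, I.G.Adj u v →
        routeTest k new I.drawnVertices (I.edgeItem u v, c (I.edgeItem u v)) = true) ∧
      (∀ u v u' v', I.G.Adj u v → I.G.Adj u' v' →
        pairTest k (I.edgeItem u v, c (I.edgeItem u v))
          (I.edgeItem u' v', c (I.edgeItem u' v')) = true)) ↔
      IsPlanarOrthogonalDrawing (⊤ : I.G.Subgraph) D ∧
        ∀ u v, I.G.Adj u v → (new = true → ¬ I.H.Adj u v) → (D.bends u v).length ≤ k) := by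
    intro c D hpos hB
    rw [I.planar_iff hV hpos hB]
    have hlen : ∀ u v, I.G.Adj u v →
        (((new && (I.edgeItem u v).2.2.1) ||
          decide ((routeBends k (I.edgeItem u v, c (I.edgeItem u v))).length ≤ k)) = true ↔
        ((new = true → ¬ I.H.Adj u v) → (D.bends u v).length ≤ k)) := by
      intro u v h
      rw [hB u v h, List.length_map]
      change ((new && decide (I.H.Adj u v)) || _) = true ↔ _
      simp only [Bool.or_eq_true, Bool.and_eq_true, decide_eq_true_iff]
      tauto
    have hopp : ∀ u v u' v', isOpposite (I.edgeItem u v) (I.edgeItem u' v') = true ↔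
        u = v' ∧ v = u' := by
      intro u v u' v'
      simp [isOpposite, edgeItem, hinj.eq_iff]
    simp only [routeTest, pairTest, Bool.and_eq_true (_ || decide _), Bool.and_eq_true]
    constructor
    · rintro ⟨h₁, h₂⟩
      refine ⟨⟨fun u v h => ⟨(h₁ u v h).2.1, (h₁ u v h).2.2.1, (h₁ u v h).2.2.2⟩,
        fun u v u' v' h h' => (h₂ u v u' v' h h').1, fun u v h => ?_⟩,
        fun u v h => (hlen u v h).1 (h₁ u v h).1⟩
      have h₃ := (h₂ u v v u h h.symm).2
      rw [(hopp u v v u).2 ⟨rfl, rfl⟩] at h₃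
      simpa using h₃
    · rintro ⟨⟨h₁, h₂, h₃⟩, h₄⟩
      refine ⟨fun u v h => ⟨(hlen u v h).2 (h₄ u v h), (h₁ u v h).1, (h₁ u v h).2.1,
        (h₁ u v h).2.2⟩, fun u v u' v' h h' => ⟨h₂ u v u' v' h h', ?_⟩⟩
      by_cases ho : u = v' ∧ v = u'
      · obtain ⟨rfl, rfl⟩ := ho
        simpa using .inr (h₃ _ _ h)
      · have : isOpposite (I.edgeItem u v) (I.edgeItem u' v') = false := by
          rw [← Bool.not_eq_true, hopp]
          exact ho
        simp [this]
  constructor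
  · rintro ⟨c, hc⟩
    rw [hconf] at hc
    let D : DrawingData ℝ (Fin I.n) :=
      ⟨fun v => castPoint (I.drawing.pos v),
        fun u v => (routeBends k (I.edgeItem u v, c (I.edgeItem u v))).map castPoint⟩
    obtain ⟨h₁, h₂⟩ := (hdraw c D (fun _ => rfl) fun _ _ _ => rfl).1 hc
    refine ⟨D, ⟨h₁, fun _ _ => rfl, fun u v h => ?_⟩, h₂⟩
    simp only [D, I.routeBends_edgeItem_of_adj k h]
    rfl
  · rintro ⟨D, hD, hlen⟩
    have hpos : ∀ v, D.pos v = castPoint (I.drawing.pos v) := fun v =>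
      hD.pos_eq v (hV ▸ trivial)
    have hex : ∀ e : EdgeItem, ∃ b : Bool, ∀ u v, I.G.Adj u v → e = I.edgeItem u v →
        D.bends u v = (routeBends k (e, b)).map castPoint := by
      intro e
      by_cases he : ∃ u v, I.G.Adj u v ∧ e = I.edgeItem u v
      · obtain ⟨u, v, huv, rfl⟩ := he
        obtain ⟨b, hb⟩ : ∃ b, D.bends u v =
            (routeBends k (I.edgeItem u v, b)).map castPoint := by
          by_cases h : I.H.Adj u v
          · exact ⟨true, by rw [I.routeBends_edgeItem_of_adj k h, hD.bends_eq u v h]; rfl⟩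
          · exact I.exists_routeBends hk h hpos (hD.planar.orthogonal u v huv)
              (hlen u v huv fun _ => h)
        refine ⟨b, fun u' v' _ he => ?_⟩
        obtain ⟨rfl, rfl⟩ := I.edgeItem_inj he
        exact hb
      · exact ⟨true, fun u v h h' => absurd ⟨u, v, h, h'⟩ he⟩
    choose c hc using hex
    exact ⟨c, (hconf c).2 ((hdraw c D hpos fun u v h => hc _ u v h rfl).2 ⟨hD.planar, hlen⟩)⟩

end RepExtInstance

/-! ### Reading the input -/

/-- A rational point, before the digits are read as numbers. -/
abbrev RawPoint := (Bool × List Bool × List Bool) × Bool × List Bool × List Bool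

/-- An edge, before the digits are read as numbers. -/
abbrev RawEdge := (List Bool × List Bool) × Bool × List RawPoint

/-- The contents of a pair of brackets that has been read from its right end up to some point: the
words between commas, and the points. -/
abbrev Frame := List (List Bool) × List RawPoint

/-- The point given by the words between brackets. -/
def closePoint (w : List (List Bool)) : RawPoint :=
  (((w.headD []).headD false, (w.headD []).tail, w.tail.headD []),
    ((w.tail.tail.headD []).headD false, (w.tail.tail.headD []).tail, w.tail.tail.tail.headD []))

/-- The edge given by the contents of a pair of brackets. -/
def closeEdge (f : Frame) : RawEdge :=
  ((f.1.headD [], f.1.tail.headD []), (f.1.tail.tail.headD []).headD false, f.2)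

/-- Read one symbol, going from the right to the left. The state consists of the stack of the
brackets that are open and the list of the edges. Brackets with at most three words enclose
edges, the others enclose points. -/
def parseStep (s : List Frame × List RawEdge) (c : Computability.Γ') : List Frame × List RawEdge :=
  bif decide (c = .ket) then (([[]], []) :: s.1, s.2)
  else bif decide (c = .bra) then
    bif ((s.1.headD ([], [])).1.drop 3).isEmpty then
      (s.1.tail, closeEdge (s.1.headD ([], [])) :: s.2)
    else
      (((s.1.tail.headD ([], [])).1,
        closePoint (s.1.headD ([], [])).1 :: (s.1.tail.headD ([], [])).2) :: s.1.tail.tail, s.2)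
  else bif decide (c = .comma) then
    (([] :: (s.1.headD ([], [])).1, (s.1.headD ([], [])).2) :: s.1.tail, s.2)
  else
    (((decide (c = .bit true) :: (s.1.headD ([], [])).1.headD []) ::
      (s.1.headD ([], [])).1.tail, (s.1.headD ([], [])).2) :: s.1.tail, s.2)

/-- The points of the vertices and the edges, from the reversed input. -/
def parse (l : List Computability.Γ') : List RawPoint × List RawEdge :=
  (((l.foldl parseStep ([([], [])], [])).1.headD ([], [])).2,
    (l.foldl parseStep ([([], [])], [])).2)

theorem encSize_headD_add_tail {α : Type} [TreeEnc α] (l : List α) (d : α) :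
    encSize (l.headD d) + encSize l.tail ≤ encSize l + encSize d := by
  cases l with
  | nil => simp
  | cons a l => simp; omega

theorem encSize_closePoint_le (w : List (List Bool)) : encSize (closePoint w) ≤ encSize w + 20 := by
  have hf : encSize false = 1 := rfl
  have h₁ := encSize_headD_add_tail w []
  have h₂ := encSize_headD_add_tail w.tail []
  have h₃ := encSize_headD_add_tail w.tail.tail []
  have h₄ := encSize_headD_add_tail w.tail.tail.tail []
  have h₅ := encSize_headD_add_tail (w.headD []) false
  have h₆ := encSize_headD_add_tail (w.tail.tail.headD []) false
  simp only [closePoint, encSize_prod, encSize_nil] at *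
  omega

theorem encSize_closeEdge_le (f : Frame) : encSize (closeEdge f) ≤ encSize f + 20 := by
  have hf : encSize false = 1 := rfl
  have h₁ := encSize_headD_add_tail f.1 []
  have h₂ := encSize_headD_add_tail f.1.tail []
  have h₃ := encSize_headD_add_tail f.1.tail.tail []
  have h₅ := encSize_headD_add_tail (f.1.tail.tail.headD []) false
  simp only [closeEdge, encSize_prod, encSize_nil] at *
  omega

theorem encSize_parseStep_le (s : List Frame × List RawEdge) (c : Computability.Γ') :
    encSize (parseStep s c) ≤ encSize s + 60 := by
  have h₁ := encSize_headD_add_tail s.1 ([], [])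
  have h₂ := encSize_headD_add_tail s.1.tail ([], [])
  have h₃ := encSize_closePoint_le (s.1.headD ([], [])).1
  have h₄ := encSize_closeEdge_le (s.1.headD ([], []))
  have h₅ := encSize_headD_add_tail (s.1.headD ([], [])).1 []
  have h₆ := encSize_bool (decide (c = .bit true))
  simp only [encSize_prod, encSize_nil] at h₁ h₂ h₃ h₄ h₅
  unfold parseStep
  cases decide (c = .ket) <;> cases decide (c = .bra) <;> cases decide (c = .comma) <;>
    cases ((s.1.headD ([], [])).1.drop 3).isEmpty <;>
    simp only [cond_true, cond_false, encSize_prod, encSize_cons, encSize_nil] <;> omega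

theorem PolyTime.parse : PolyTime parse := by
  have h := PolyTime.foldl_of_growth (l := fun x => x) (i := fun _ => ([([], [])], []))
    (f := fun (_ : List Computability.Γ') => parseStep) id' (const _)
    (by unfold parseStep closePoint closeEdge; fun_prop) (.C 60)
    (fun x s a => by rw [Polynomial.eval_C]; exact encSize_parseStep_le s a)
  unfold _root_.parse
  fun_prop

section Parse

open Computability

/-- Read a piece of the input. -/
def readCode (l : List Γ') (s : List Frame × List RawEdge) : List Frame × List RawEdge :=
  l.foldr (fun c s => parseStep s c) s

theorem readCode_append (l l' : List Γ') (s : List Frame × List RawEdge) :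
    readCode (l ++ l') s = readCode l (readCode l' s) := List.foldr_append ..

theorem readCode_cons (c : Γ') (l : List Γ') (s : List Frame × List RawEdge) :
    readCode (c :: l) s = parseStep (readCode l s) c := rfl

theorem readCode_nil (s : List Frame × List RawEdge) : readCode [] s = s := rfl

theorem parseStep_ket (st : List Frame) (E : List RawEdge) :
    parseStep (st, E) .ket = (([[]], []) :: st, E) := rfl

theorem parseStep_comma (w : List (List Bool)) (ps : List RawPoint) (st : List Frame)
    (E : List RawEdge) : parseStep ((w, ps) :: st, E) .comma = (([] :: w, ps) :: st, E) := rfl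

theorem parseStep_bit (b : Bool) (a : List Bool) (w : List (List Bool)) (ps : List RawPoint)
    (st : List Frame) (E : List RawEdge) :
    parseStep ((a :: w, ps) :: st, E) (.bit b) = (((b :: a) :: w, ps) :: st, E) := by
  cases b <;> rfl

theorem readCode_natCode (m : ℕ) (a : List Bool) (w : List (List Bool)) (ps : List RawPoint)
    (st : List Frame) (E : List RawEdge) : readCode (natCode m) ((a :: w, ps) :: st, E) =
      (((encodeNat m ++ a) :: w, ps) :: st, E) := by
  rw [natCode]
  induction encodeNat m with
  | nil => rfl
  | cons b l ih => rw [List.map_cons, readCode_cons, ih, parseStep_bit]; rfl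

theorem readCode_ratCode (q : ℚ) (w : List (List Bool)) (ps : List RawPoint)
    (st : List Frame) (E : List RawEdge) : readCode (ratCode q) ((w, ps) :: st, E) =
      ((((ratParts q).1 :: (ratParts q).2.1) :: (ratParts q).2.2 :: w, ps) :: st, E) := by
  simp only [ratCode, readCode_append, readCode_cons, readCode_nil, parseStep_comma,
    readCode_natCode, parseStep_bit, ratParts, List.append_nil]

/-- The coordinates of a point in binary. -/
def rawPoint (p : RatPoint) : RawPoint := (ratParts p.1, ratParts p.2)

theorem readCode_pointCode (p : RatPoint) (w : List (List Bool)) (ps : List RawPoint)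
    (st : List Frame) (E : List RawEdge) : readCode (pointCode p) ((w, ps) :: st, E) =
      ((w, rawPoint p :: ps) :: st, E) := by
  simp only [pointCode, readCode_append, readCode_cons, readCode_nil, parseStep_ket,
    readCode_ratCode]
  rfl

theorem readCode_flatMap_pointCode (l : List RatPoint) (w : List (List Bool)) (ps : List RawPoint)
    (st : List Frame) (E : List RawEdge) : readCode (l.flatMap pointCode) ((w, ps) :: st, E) =
      ((w, l.map rawPoint ++ ps) :: st, E) := by
  induction l with
  | nil => rfl
  | cons p l ih => rw [List.flatMap_cons, readCode_append, ih, readCode_pointCode]; rfl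

/-- The numbers of an edge in binary. -/
def rawEdge (e : (ℕ × ℕ) × Bool × List RatPoint) : RawEdge :=
  ((encodeNat e.1.1, encodeNat e.1.2), e.2.1, e.2.2.map rawPoint)

theorem readCode_edgeCode (I : RepExtInstance) (e : Fin I.n × Fin I.n) (f : Frame)
    (st : List Frame) (E : List RawEdge) [Decidable (I.H.Adj e.1 e.2)] :
    readCode (I.edgeCode e) (f :: st, E) =
      (f :: st, rawEdge (((e.1 : ℕ), (e.2 : ℕ)), decide (I.H.Adj e.1 e.2), I.givenBends e.1 e.2) ::
        E) := by
  by_cases h : I.H.Adj e.1 e.2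
  · simp only [RepExtInstance.edgeCode, h, if_true, readCode_append, readCode_cons, readCode_nil,
      parseStep_ket, readCode_flatMap_pointCode, parseStep_bit, parseStep_comma, readCode_natCode,
      RepExtInstance.givenBends, decide_true, List.append_nil]
    rfl
  · simp only [RepExtInstance.edgeCode, h, if_false, readCode_append, readCode_cons, readCode_nil,
      parseStep_ket, parseStep_bit, parseStep_comma, readCode_natCode,
      RepExtInstance.givenBends, decide_false, List.append_nil]
    rfl

/-- Reading the code of an instance yields its points and edges. All vertices are drawn, so no
vertex is coded by a blank. -/
theorem parse_encode (I : RepExtInstance) (hV : I.H.verts = Set.univ) :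
    parse I.encode.reverse =
      (((List.finRange I.n).map I.drawing.pos).map rawPoint, I.edgeData.map rawEdge) := by
  classical
  have hv : (List.finRange I.n).flatMap I.vertexCode =
      ((List.finRange I.n).map I.drawing.pos).flatMap pointCode := by
    rw [List.flatMap_map]
    congr 1
    funext v
    simp [RepExtInstance.vertexCode, hV]
  have he : ∀ l : List (Fin I.n × Fin I.n), readCode (l.flatMap I.edgeCode) ([([], [])], []) =
      ([([], [])], l.map fun e => rawEdge (((e.1 : ℕ), (e.2 : ℕ)), decide (I.H.Adj e.1 e.2),
        I.givenBends e.1 e.2)) := by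
    intro l
    induction l with
    | nil => rfl
    | cons e l ih => rw [List.flatMap_cons, readCode_append, ih, readCode_edgeCode]; rfl
  have h : I.encode.reverse.foldl parseStep ([([], [])], []) =
      ([([[]], ((List.finRange I.n).map I.drawing.pos).map rawPoint)],
        I.edgeData.map rawEdge) := by
    rw [List.foldl_reverse]
    change readCode I.encode _ = _
    rw [RepExtInstance.encode, readCode_append, readCode_append, he, hv, readCode_cons,
      readCode_nil, parseStep_comma, readCode_flatMap_pointCode, RepExtInstance.edgeData,
      List.map_map, List.append_nil]
    congr 1
    rw [List.map_map]
    refine List.map_congr_left fun e _ => ?_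
    simp only [Function.comp_apply]
  rw [parse, h]
  rfl

theorem enc_list_map {α β : Type} [TreeEnc α] [TreeEnc β] {f : α → β}
    (h : ∀ a, TreeEnc.enc (f a) = TreeEnc.enc a) (l : List α) :
    TreeEnc.enc (l.map f) = TreeEnc.enc l := by
  induction l with
  | nil => rfl
  | cons a l ih =>
    change BTree.cons (TreeEnc.enc (f a)) (TreeEnc.enc (l.map f)) = BTree.cons _ (TreeEnc.enc l)
    rw [h, ih]

theorem enc_rawPoint (p : RatPoint) : TreeEnc.enc (rawPoint p) = TreeEnc.enc p := rfl

/-- Numbers have the same code as their lists of digits, so no conversion is needed. -/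
theorem enc_parse_encode (I : RepExtInstance) (hV : I.H.verts = Set.univ) :
    TreeEnc.enc (parse I.encode.reverse) =
      TreeEnc.enc ((List.finRange I.n).map I.drawing.pos, I.edgeData) := by
  rw [parse_encode I hV]
  have h : ∀ e, TreeEnc.enc (rawEdge e) = TreeEnc.enc e := fun e => by
    change BTree.cons _ (BTree.cons _ (TreeEnc.enc (e.2.2.map rawPoint))) = _
    rw [enc_list_map enc_rawPoint]
    rfl
  change BTree.cons _ _ = BTree.cons _ _
  congr 1
  · exact enc_list_map enc_rawPoint _
  · exact enc_list_map h _

end Parse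

/-! ### Machines that read their input -/

namespace Prog

open Computability

/-- The control points of the machine that runs a program: those of the program, one for each
symbol of the input that has just been read, and three more, at which the machine starts, reads the
next symbol, and finishes. -/
abbrev MachineLabel (P : Prog) := Label P ⊕ Γ' ⊕ Fin 3

/-- Put bits on top of the main stack. -/
def pushBits {Λ : Type} : List Bool → MStmt Λ → MStmt Λ
  | [], q => q
  | b :: l, q => pushBits l (.push (some Reg.main) (fun _ => b) q)

theorem stepAux_pushBits {Λ : Type} (l : List Bool) (q : MStmt Λ) (v : Option Γ') (i : List Γ')
    (m : List Bool) :
    Turing.TM2.stepAux (pushBits l q) v (contents i (mainOnly m)) =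
      Turing.TM2.stepAux q v (contents i (mainOnly (l ++ m))) := by
  induction l generalizing q with
  | nil => rfl
  | cons b l ih => simp [pushBits, ih, update_contents, Turing.TM2.stepAux, contents, mainOnly,
      Store.get, Store.set]

/-- The machine that puts the code of its reversed input on the main stack, runs a program, and
replaces the code of the Boolean value that this leaves on the main stack by the value itself. -/
def machine (P : Prog) : MachineLabel P → MStmt (MachineLabel P)
  | .inl l => stmt P Sum.inl (.inr (.inr 2)) l
  | .inr (.inl c) => pushBits (true :: (TreeEnc.enc c).code) (.goto fun _ => .inr (.inr 1))
  | .inr (.inr 0) => pushBits [false] (.goto fun _ => .inr (.inr 1))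
  | .inr (.inr 1) => .pop none (fun _ c => c) (.goto fun v =>
      match v with
      | none => .inl (entry P)
      | some c => .inr (.inl c))
  -- The code of `true` has two more bits, which are removed before halting with an empty memory.
  | .inr (.inr 2) => .pop (some Reg.main) (fun _ b => b.map Γ'.bit)
      (.branch (fun v => v = some (.bit true))
      (.pop (some Reg.main) (fun _ _ => none) (.pop (some Reg.main) (fun _ _ => none)
        (pushBits [true] .halt)))
      (.load (fun _ => none) (pushBits [false] .halt)))

/-- Symbols are added at the front of the list that is coded on the main stack, so that reading
reverses the input. -/
theorem steps_read (P : Prog) (l : List Γ') : ∀ (r : List Γ') (v : Option Γ'),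
    Steps (machine P) (2 * l.length + 1)
      ⟨some (.inr (.inr 1)), v, contents l (mainOnly (TreeEnc.enc r).code)⟩
      ⟨some (.inl (entry P)), none,
        contents [] (mainOnly (TreeEnc.enc (l.reverse ++ r)).code)⟩ := by
  induction l with
  | nil =>
    intro r v
    have h := Steps.one (M := machine P) (l := .inr (.inr 1)) (v := v)
      (S := contents [] (mainOnly (TreeEnc.enc r).code))
    have hu : Function.update (contents [] (mainOnly (TreeEnc.enc r).code)) none [] =
      contents [] (mainOnly (TreeEnc.enc r).code) := Function.update_eq_self _ _
    simpa [machine, Turing.TM2.stepAux, contents, hu] using h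
  | cons c l ih =>
    intro r v
    have h := Steps.one (M := machine P) (l := .inr (.inr 1)) (v := v)
      (S := contents (c :: l) (mainOnly (TreeEnc.enc r).code))
    have hu : Function.update (contents (c :: l) (mainOnly (TreeEnc.enc r).code)) none l =
        contents l (mainOnly (TreeEnc.enc r).code) := by
      funext k
      rcases k with _ | k
      · simp [contents]
      · simp [contents]
    have h' := Steps.one (M := machine P) (l := .inr (.inl c)) (v := some c)
      (S := contents l (mainOnly (TreeEnc.enc r).code))
    simp only [machine, stepAux_pushBits, Turing.TM2.stepAux] at h'
    simp only [machine, Turing.TM2.stepAux, contents, List.head?_cons, List.tail_cons, hu] at h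
    have := (h.trans h').trans (ih (c :: r) (some c))
    rw [List.reverse_cons, List.append_assoc, List.length_cons,
      show 2 * (l.length + 1) + 1 = 1 + 1 + (2 * l.length + 1) by ring]
    exact this

theorem steps_finish (P : Prog) (b : Bool) (v : Option Γ') :
    Steps (machine P) 1
      ⟨some (.inr (.inr 2)), v, contents [] (mainOnly (TreeEnc.enc b).code)⟩
      ⟨none, none, contents [] (mainOnly [b])⟩ := by
  refine Eq.trans Steps.one ?_
  cases b <;>
  simp [machine, TreeEnc.enc, BTree.ofBool, BTree.code, Turing.TM2.stepAux, contents,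
    update_contents, mainOnly, Store.get, Store.set, pushBits]

/-- A machine runs through the program on the code of its reversed input. -/
theorem steps_machine {P : Prog} {l : List Γ'} {b : Bool} {t : ℕ}
    (h : Run P (mainOnly (TreeEnc.enc l.reverse).code) (mainOnly (TreeEnc.enc b).code) t) :
    Steps (machine P) (2 * l.length + t + 3) ⟨some (.inr (.inr 0)), none, contents l (mainOnly [])⟩
      ⟨none, none, contents [] (mainOnly [b])⟩ := by
  have h₁ := Steps.one (M := machine P) (l := .inr (.inr 0)) (v := none)
    (S := contents l (mainOnly []))
  simp only [machine, stepAux_pushBits, Turing.TM2.stepAux] at h₁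
  have h₂ := steps_read P l [] none
  rw [List.append_nil] at h₂
  obtain ⟨v, h₃⟩ := h.steps (M := machine P) [] Sum.inl (.inr (.inr 2)) (fun _ => rfl) none
  have := (h₁.trans h₂).trans (h₃.trans (steps_finish P b v))
  rwa [show 2 * l.length + t + 3 = 1 + (2 * l.length + 1) + (t + 1) by ring]

/-- The bundled machine of a program. -/
def finMachine (P : Prog) : Turing.FinTM2 where
  K := Option Reg
  k₀ := none
  k₁ := some .main
  Γ := StackAlphabet
  Λ := MachineLabel P
  main := .inr (.inr 0)
  σ := Option Γ'
  initialState := none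
  Γk₀Fin := inferInstanceAs (Fintype Γ')
  m := machine P

theorem initList_finMachine (P : Prog) (l : List Γ') : Turing.initList (finMachine P) l =
    ⟨some (.inr (.inr 0)), none, contents l (mainOnly [])⟩ := by
  unfold Turing.initList
  congr 1
  funext k
  rcases k with _ | k
  · rfl
  · cases k <;> rfl

theorem haltList_finMachine (P : Prog) (m : List Bool) : Turing.haltList (finMachine P) m =
    ⟨none, none, contents [] (mainOnly m)⟩ := by
  unfold Turing.haltList
  congr 1
  funext k
  rcases k with _ | k
  · rfl
  · cases k <;> rfl

end Prog

theorem encSize_symbols_le (l : List Computability.Γ') : encSize l ≤ 12 * l.length + 1 := by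
  have h : ∀ c : Computability.Γ', encSize c ≤ 11 := by
    rintro (_ | b | _)
    all_goals first | (cases b <;> decide) | decide
  induction l with
  | nil => simp
  | cons c l ih => have := h c; simp; omega

open Polynomial in
/-- A polynomial-time function of the data that a polynomial-time function extracts from the
reversed code is computed by a Turing machine in polynomial time. -/
theorem PolyTime.tm2Computable {α δ ρ : Type} [TreeEnc δ] [TreeEnc ρ]
    (code : α → List Computability.Γ') (data : α → δ) {parse : List Computability.Γ' → ρ}
    (hp : PolyTime parse)
    (hdata : ∀ a, TreeEnc.enc (parse (code a).reverse) = TreeEnc.enc (data a))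
    {f : δ → Bool} (hf : PolyTime f) :
    Nonempty (Turing.TM2ComputableInPolyTime code Computability.encodeBool
      (fun a => f (data a))) := by
  obtain ⟨Q, hQ⟩ := hp.exists_size_le
  obtain ⟨P₁, p₁, h₁⟩ := hp
  obtain ⟨P₂, p₂, h₂⟩ := hf
  have hrun : ∀ a, ∃ t, Prog.Run (.seq P₁ P₂)
      (Prog.mainOnly (TreeEnc.enc (code a).reverse).code)
      (Prog.mainOnly (TreeEnc.enc (f (data a))).code) t ∧
      2 * (code a).length + t + 3 ≤
        (C 2 * X + (p₁ + p₂.comp Q).comp (C 12 * X + 1) + C 3).eval (code a).length := by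
    intro a
    obtain ⟨t₁, ht₁, r₁⟩ := h₁ (code a).reverse []
    obtain ⟨t₂, ht₂, r₂⟩ := h₂ (data a) []
    rw [hdata] at r₁
    simp only [List.append_nil] at r₁ r₂
    refine ⟨t₁ + t₂, .seq r₁ r₂, ?_⟩
    have hl : encSize (code a).reverse ≤ 12 * (code a).length + 1 := by
      simpa using encSize_symbols_le (code a).reverse
    have hd : encSize (data a) ≤ Q.eval (encSize (code a).reverse) := by
      have := hQ (code a).reverse
      rwa [encSize, hdata] at this
    have e₁ := ht₁.trans (eval_le hl)
    have e₂ := ht₂.trans (eval_le (hd.trans (eval_le hl)))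
    simp only [eval_add, eval_mul, eval_C, eval_X, eval_comp, eval_one]
    omega
  choose t ht htime using hrun
  exact ⟨{
    tm := Prog.finMachine (.seq P₁ P₂)
    inputAlphabet := Equiv.refl _
    outputAlphabet := Equiv.refl _
    time := C 2 * X + (p₁ + p₂.comp Q).comp (C 12 * X + 1) + C 3
    outputsFun := fun a => {
      steps := 2 * (code a).length + t a + 3
      evals_in_steps := by
        have h := Prog.steps_machine (ht a)
        have e₀ : (code a).map (Equiv.refl Computability.Γ').invFun = code a := List.map_id _
        have e₁ : (Computability.encodeBool (f (data a))).map (Equiv.refl Bool).invFun =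
          [f (data a)] := rfl
        erw [e₀, e₁, Option.map_some, Prog.initList_finMachine, Prog.haltList_finMachine]
        exact h
      steps_le_m := htime a } }⟩

theorem theorem7 (k : ℕ) (hk : k = 0 ∨ k = 1) :
    DecidableInPolyTime
      (fun I : {I : RepExtInstance // I.H.verts = Set.univ} => I.1.encode)
      (fun I => I.1.HasExtension k) ∧
    DecidableInPolyTime
      (fun I : {I : RepExtInstance // I.H.verts = Set.univ} => I.1.encode)
      (fun I => I.1.HasExtensionNewEdges k) := by
  have h (new : Bool) := PolyTime.tm2Computable
    (fun I : {I : RepExtInstance // I.H.verts = Set.univ} => I.1.encode)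
    (fun I => ((List.finRange I.1.n).map I.1.drawing.pos, I.1.edgeData)) PolyTime.parse
    (fun I => enc_parse_encode I.1 I.2) (PolyTime.extensionTest k new)
  refine ⟨⟨_, fun I => ?_, h false⟩, ⟨_, fun I => ?_, h true⟩⟩
  · rw [I.1.extensionTest_iff I.2 hk]
    simp [RepExtInstance.HasExtension]
  · rw [I.1.extensionTest_iff I.2 hk]
    simp [RepExtInstance.HasExtensionNewEdges]
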